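/- **Setting.** Let $\mathcal A=\{H_1,\dots,H_n\}$ be an arrangement of $n$ distinct affine lines in $\mathbb R^2$. Chambers are the connected components of $\mathbb R^2\setminus\bigcup_i H_i$, and $\operatorname{Sep}(C,C')$ is the set of lines that have the chambers $C,C'$ on opposite sides. Fix a flag $\emptyset=\mathcal F^{-1}\subset\mathcal F^0\subset\mathcal F^1\subset\mathcal F^2=\mathbb R^2$, where $\mathcal F^0$ is a point and $\mathcal F^1$ an oriented line, such that $\mathcal F^0\notin\bigcup_i H_i$, $\mathcal F^1$ meets $\bigcup_i H_i$ in $n$ distinct points $\mathcal F^1\cap H_i$, $\mathcal F^0$ does not separate these points in $\mathcal F^1$, and $\mathcal F^1$ does not separate the intersection points of $\mathcal A$ in $\mathbb R^2$. Orient $\mathcal F^1$ and number the lines so that $\mathcal F^0<\mathcal F^1\cap H_1<\dots<\mathcal F^1\cap H_n$ on $\mathcal F^1$. Let $H_i^-$ and $H_i^+$ be the open sides of $H_i$ with $\mathcal F^0\in H_i^-$. Let $\mathrm{ch}^k$ be the set of chambers that do not meet $\mathcal F^{k-1}$ and meet $\mathcal F^k$. Then $\mathrm{ch}^0$ consists of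 the chamber $C_0$ that contains $\mathcal F^0$, and $\mathrm{ch}^1=\{C_1,\dots,C_n\}$ with $\operatorname{Sep}(C_0,C_i)=\{H_1,\dots,H_i\}$. Let $R$ be a commutative ring, $a_1,\dots,a_n\in R$, and $\eta=\sum_i a_ie_i\in A^1_R(\mathcal A)$, where $A_R^\bullet(\mathcal A)$ is the Orlik–Solomon algebra with generators $e_1,\dots,e_n$: the quotient of the exterior algebra by the ideal generated by all monomials $e_S$ with $\bigcap_{i\in S}H_i=\emptyset$ and all $\partial e_S$ with $\bigcap_{i\in S}H_i\ne\emptyset$ and linearly dependent equations of the lines $H_i$, $i\in S$ (here $\partial$ is the derivation of degree $-1$ with $\partial e_i=1$). The maps $\nabla_\eta\colon R[\mathrm{ch}^0]\to R[\mathrm{ch}^1]\to R[\mathrm{ch}^2]$ are $$\nabla_\eta[C_0]=\sum_{i=1}^n\Big(\sum_{H_j\in\operatorname{Sep}(C_0,C_i)}a_j\Big)[C_i],\qquad \nabla_\eta[C_i]=\sum_{D\in\mathrm{ch}^2}\deg(C_i,D)\Big(\sum_{H_j\in\operatorname{Sep}(C_i,D)}a_j\Big)[D].$$ For $i<n$,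 $\deg(C_i,D)$ is $1$ if $D\subset H_i^-\cap H_{i+1}^+$, $-1$ if $D\subset H_i^+\cap H_{i+1}^-$, and $0$ otherwise; $\deg(C_n,D)$ is $-1$ if $D\subset H_n^+$ and $0$ otherwise. A band $B$ is the region $H_i^+\cap H_{i+1}^-$ between two consecutive parallel lines $H_i,H_{i+1}$. Let $U_1(B)=C_i$ be the unbounded chamber in $B$ that meets $\mathcal F^1$, and $U_2(B)$ the other unbounded chamber contained in $B$ (if all lines of $\mathcal A$ are parallel, $B$ is itself a chamber and $U_2(B)=U_1(B)$). The band $B$ is $\eta$-resonant if $\sum_{H_j\in\operatorname{Sep}(U_1(B),U_2(B))}a_j=0$. Let $\mathrm{RB}_\eta$ be the set of $\eta$-resonant bands, extend $U_1$ linearly to $R[\mathrm{RB}_\eta]\to R[\mathrm{ch}^1]$, and put $\widetilde\nabla_\eta=-\nabla_\eta\circ U_1\colon R[\mathrm{RB}_\eta]\to R[\mathrm{ch}^2]$. **Theorem.** $(R[\mathrm{ch}^\bullet],\nabla_\eta)$ is a cochain complex, and $[C_i]\mapsto e_i-e_{i+1}$ $(i<n)$, $[C_n]\mapsto e_n$ induces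 an isomorphism from $H^1(R[\mathrm{ch}^\bullet],\nabla_\eta)$ onto $H^1(A_R^\bullet(\mathcal A),\eta)$, the cohomology of the Aomoto complex (whose differential is multiplication by $\eta$). Let $$\widetilde U_1\colon \operatorname{Ker}(\widetilde\nabla_\eta)\to H^1(R[\mathrm{ch}^\bullet],\nabla_\eta)$$ be the map induced by $U_1$, and let $\alpha=\sum_{i=1}^na_i$. 1. If $\alpha\in R^\times$, then $\widetilde U_1$ is injective. 2. If $R$ is an integral domain and $\alpha\in R^\times$, then $\widetilde U_1$ is an isomorphism. 3. If $\alpha\in R^\times$ and all bands are $\eta$-resonant ($R$ an arbitrary commutative ring), then $\widetilde U_1$ is an isomorphism. -/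

import Mathlib

/-! Real affine line arrangements, their chambers, flags near infinity, the chamber complex,
bands, and the Orlik-Solomon algebra with its Aomoto complex. -/

/-- A numbered arrangement of `n` distinct affine lines `H i = {x | form i x = 0}` in the real
plane, given by defining linear polynomials. -/
structure LineArrangement (n : ℕ) where
  /-- the defining polynomials, of degree one -/
  form : Fin n → (ℝ × ℝ →ᵃ[ℝ] ℝ)
  linear_ne_zero : ∀ i, (form i).linear ≠ 0
  line_injective : Function.Injective fun i => {x : ℝ × ℝ | form i x = 0}

namespace LineArrangement

noncomputable section

open scoped Classical

variable {n : ℕ}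

/-- The line `H i`. -/
def line (A : LineArrangement n) (i : Fin n) : Set (ℝ × ℝ) := {x | A.form i x = 0}

/-- The complement in the plane of the union of the lines. -/
def compl (A : LineArrangement n) : Set (ℝ × ℝ) := {x | ∀ i, x ∉ A.line i}

/-- Chambers: connected components of the complement. -/
def Chamber (A : LineArrangement n) : Type :=
  {C : Set (ℝ × ℝ) // ∃ x ∈ A.compl, C = connectedComponentIn A.compl x}

/-- The chamber that contains a given point of the complement. -/
def chamberAt (A : LineArrangement n) (x : ℝ × ℝ) (hx : x ∈ A.compl) : A.Chamber :=
  ⟨connectedComponentIn A.compl x, x, hx, rfl⟩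

theorem mem_chamberAt (A : LineArrangement n) (x : ℝ × ℝ) (hx : x ∈ A.compl) :
    x ∈ (A.chamberAt x hx).1 := mem_connectedComponentIn hx

theorem Chamber.nonempty {A : LineArrangement n} (C : A.Chamber) : C.1.Nonempty := by
  obtain ⟨C, x, hx, rfl⟩ := C
  exact ⟨x, mem_connectedComponentIn hx⟩

theorem Chamber.subset_compl {A : LineArrangement n} (C : A.Chamber) : C.1 ⊆ A.compl := by
  obtain ⟨C, x, hx, rfl⟩ := C
  exact connectedComponentIn_subset _ _

theorem Chamber.eq_chamberAt {A : LineArrangement n} (C : A.Chamber) {x : ℝ × ℝ} (hx : x ∈ C.1) :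
    C = A.chamberAt x (C.subset_compl hx) := by
  obtain ⟨C, y, hy, rfl⟩ := C
  exact Subtype.ext (connectedComponentIn_eq hx)

/-- Every defining polynomial has constant sign on a chamber. -/
theorem Chamber.sign {A : LineArrangement n} (C : A.Chamber) {x y : ℝ × ℝ} (hx : x ∈ C.1)
    (hy : y ∈ C.1) (i : Fin n) : 0 < A.form i x * A.form i y := by
  have hpre : IsPreconnected C.1 := by
    obtain ⟨C, z, hz, rfl⟩ := C
    exact isPreconnected_connectedComponentIn
  have hcont : Continuous (A.form i) := AffineMap.continuous_of_finiteDimensional _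
  have h0 : (0 : ℝ) ∉ (A.form i) '' C.1 := by
    rintro ⟨z, hz, h⟩
    exact C.subset_compl hz i h
  have hx0 : A.form i x ≠ 0 := fun h => h0 ⟨x, hx, h⟩
  have hy0 : A.form i y ≠ 0 := fun h => h0 ⟨y, hy, h⟩
  have hord := (hpre.image _ hcont.continuousOn).ordConnected
  rcases lt_or_gt_of_ne hx0 with h | h <;> rcases lt_or_gt_of_ne hy0 with h' | h'
  · exact mul_pos_of_neg_of_neg h h'
  · exact absurd (hord.out ⟨x, hx, rfl⟩ ⟨y, hy, rfl⟩ ⟨h.le, h'.le⟩) h0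
  · exact absurd (hord.out ⟨y, hy, rfl⟩ ⟨x, hx, rfl⟩ ⟨h'.le, h.le⟩) h0
  · exact mul_pos h h'

theorem form_lineMap (A : LineArrangement n) (i : Fin n) (x y : ℝ × ℝ) (s t : ℝ)
    (hst : s + t = 1) : A.form i (s • x + t • y) = s * A.form i x + t * A.form i y := by
  have := Convex.combo_affine_apply (f := A.form i) (x := x) (y := y) hst
  simpa using this

/-- Two chambers on which the defining polynomials have the same signs are equal. -/
theorem Chamber.eq_of_sign {A : LineArrangement n} (C D : A.Chamber) {x y : ℝ × ℝ}
    (hx : x ∈ C.1) (hy : y ∈ D.1) (h : ∀ i, 0 < A.form i x * A.form i y) : C = D := by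
  have hsub : segment ℝ x y ⊆ A.compl := by
    rintro z ⟨s, t, hs, ht, hst, rfl⟩ i hz
    have hz' : s * A.form i x + t * A.form i y = 0 := by
      rw [← A.form_lineMap i x y s t hst]; exact hz
    have hi := h i
    rcases pos_and_pos_or_neg_and_neg_of_mul_pos hi with ⟨h1, h2⟩ | ⟨h1, h2⟩
    · rcases hs.eq_or_lt with rfl | hs
      · have : t = 1 := by linarith
        subst this; linarith
      · nlinarith [mul_pos hs h1, mul_nonneg ht h2.le]
    · rcases hs.eq_or_lt with rfl | hs
      · have : t = 1 := by linarith
        subst this; linarith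
      · nlinarith [mul_neg_of_pos_of_neg hs h1, mul_nonpos_of_nonneg_of_nonpos ht h2.le]
  rw [C.eq_chamberAt hx, D.eq_chamberAt hy]
  refine Subtype.ext (connectedComponentIn_eq ?_)
  exact (convex_segment x y).isPreconnected.subset_connectedComponentIn
    (left_mem_segment ℝ x y) hsub (right_mem_segment ℝ x y)

instance (A : LineArrangement n) : Finite A.Chamber := by
  refine Finite.of_injective
    (fun C : A.Chamber => fun i : Fin n => decide (0 < A.form i C.nonempty.some)) ?_
  intro C D hCD
  refine C.eq_of_sign D C.nonempty.some_mem D.nonempty.some_mem fun i => ?_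
  have hC : A.form i C.nonempty.some ≠ 0 := C.subset_compl C.nonempty.some_mem i
  have hD : A.form i D.nonempty.some ≠ 0 := D.subset_compl D.nonempty.some_mem i
  have hi := congrFun hCD i
  simp only [decide_eq_decide] at hi
  by_cases h : 0 < A.form i C.nonempty.some
  · exact mul_pos h (hi.1 h)
  · exact mul_pos_of_neg_of_neg (lt_of_le_of_ne (not_lt.1 h) hC)
      (lt_of_le_of_ne (not_lt.1 fun h' => h (hi.2 h')) hD)

/-- `Sep(C, D)`: the (indices of) lines that have `C` and `D` on opposite sides. -/
def Sep (A : LineArrangement n) (C D : A.Chamber) : Finset (Fin n) :=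
  {i | ∀ x ∈ C.1, ∀ y ∈ D.1, A.form i x * A.form i y < 0}

/-- A generic oriented flag `F⁰ ⊂ F¹` near infinity, with `F⁰ = {pt}` and
`F¹ = {pt + t • dir | t ∈ ℝ}`, for an arrangement whose lines are numbered in the order in which
`F¹` meets them after `F⁰`. -/
structure Flag (A : LineArrangement n) where
  pt : ℝ × ℝ
  dir : ℝ × ℝ
  dir_ne_zero : dir ≠ 0
  /-- the parameter of the point in which `F¹` meets `H i` -/
  cross : Fin n → ℝ
  /-- `F¹ ∩ H i` is the single point with parameter `cross i` -/
  mem_line_iff : ∀ i t, pt + t • dir ∈ A.line i ↔ t = cross i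
  /-- `F⁰` is on no line, and it does not separate the points `F¹ ∩ H i` in `F¹` -/
  cross_pos : ∀ i, 0 < cross i
  /-- the points `F¹ ∩ H i` are distinct and in the order of the numbering -/
  cross_strictMono : StrictMono cross
  /-- `F¹` does not separate intersection points of the arrangement -/
  not_separates : ∀ i j k l, i ≠ j → k ≠ l → ∀ x ∈ A.line i ∩ A.line j,
    ∀ y ∈ A.line k ∩ A.line l,
      Disjoint (segment ℝ x y) (Set.range fun t : ℝ => pt + t • dir)

namespace Flag

variable {A : LineArrangement n}

/-- The spaces of the flag, with the index shifted by one: `space k` is `F^{k-1}`, so the values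
are `∅`, the point, the line, the plane. -/
def space (F : A.Flag) : ℕ → Set (ℝ × ℝ)
  | 0 => ∅
  | 1 => {F.pt}
  | 2 => Set.range fun t : ℝ => F.pt + t • F.dir
  | _ => Set.univ

/-- `ch^k`: the chambers that do not meet `F^{k-1}` and meet `F^k`. -/
def ch (F : A.Flag) (k : ℕ) : Type :=
  {C : A.Chamber // C.1 ∩ F.space k = ∅ ∧ (C.1 ∩ F.space (k + 1)).Nonempty}

instance (F : A.Flag) (k : ℕ) : Finite (F.ch k) := Subtype.finite

instance (F : A.Flag) (k : ℕ) : Fintype (F.ch k) := Fintype.ofFinite _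

/-- The open half plane `H i ^ -`, the side of `H i` that contains `F⁰`. -/
def neg (F : A.Flag) (i : Fin n) : Set (ℝ × ℝ) := {x | 0 < A.form i x * A.form i F.pt}

/-- The open half plane `H i ^ +`, the side of `H i` that does not contain `F⁰`. -/
def pos (F : A.Flag) (i : Fin n) : Set (ℝ × ℝ) := {x | A.form i x * A.form i F.pt < 0}

theorem mem_neg (F : A.Flag) {i : Fin n} {x : ℝ × ℝ} :
    x ∈ F.neg i ↔ 0 < A.form i x * A.form i F.pt := Iff.rfl

theorem mem_pos (F : A.Flag) {i : Fin n} {x : ℝ × ℝ} :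
    x ∈ F.pos i ↔ A.form i x * A.form i F.pt < 0 := Iff.rfl

theorem form_pt_ne (F : A.Flag) (i : Fin n) : A.form i F.pt ≠ 0 := fun h => by
  have := (F.mem_line_iff i 0).1 (by simpa [line] using h)
  exact (F.cross_pos i).ne this

/-- The defining polynomials along `F¹`. -/
theorem form_mul (F : A.Flag) (i : Fin n) (t : ℝ) :
    F.cross i * A.form i (F.pt + t • F.dir) = (F.cross i - t) * A.form i F.pt := by
  have h1 : ∀ s : ℝ, A.form i (F.pt + s • F.dir) = A.form i F.pt + s * (A.form i).linear F.dir := by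
    intro s
    have := (A.form i).map_vadd F.pt (s • F.dir)
    simp only [vadd_eq_add, map_smul, smul_eq_mul] at this
    rw [add_comm F.pt, this, add_comm]
  have h2 : A.form i (F.pt + F.cross i • F.dir) = 0 := (F.mem_line_iff i _).2 rfl
  rw [h1] at h2 ⊢
  linear_combination t * h2

theorem mem_neg_iff (F : A.Flag) (i : Fin n) (t : ℝ) :
    F.pt + t • F.dir ∈ F.neg i ↔ t < F.cross i := by
  have h := F.form_mul i t
  have hc := F.cross_pos i
  have hp : 0 < A.form i F.pt * A.form i F.pt := mul_self_pos.2 (F.form_pt_ne i)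
  have key : F.cross i * (A.form i (F.pt + t • F.dir) * A.form i F.pt)
      = (F.cross i - t) * (A.form i F.pt * A.form i F.pt) := by linear_combination A.form i F.pt * h
  rw [neg, Set.mem_ofPred_eq, ← mul_pos_iff_of_pos_left hc, key, mul_pos_iff_of_pos_right hp,
    sub_pos]

theorem mem_pos_iff (F : A.Flag) (i : Fin n) (t : ℝ) :
    F.pt + t • F.dir ∈ F.pos i ↔ F.cross i < t := by
  have h := F.form_mul i t
  have hc := F.cross_pos i
  have hp : 0 < A.form i F.pt * A.form i F.pt := mul_self_pos.2 (F.form_pt_ne i)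
  have key : F.cross i * -(A.form i (F.pt + t • F.dir) * A.form i F.pt)
      = (t - F.cross i) * (A.form i F.pt * A.form i F.pt) := by
    linear_combination -(A.form i F.pt) * h
  rw [pos, Set.mem_ofPred_eq, ← neg_pos, ← mul_pos_iff_of_pos_left hc, key,
    mul_pos_iff_of_pos_right hp, sub_pos]

/-- The parameter of a point of `F¹` that lies after `H i` and before `H (i+1)`
(after `H i` if `H i` is the last line). -/
def sample (F : A.Flag) (i : Fin n) : ℝ :=
  if h : i.1 + 1 < n then (F.cross i + F.cross ⟨i.1 + 1, h⟩) / 2 else F.cross i + 1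

theorem cross_lt_sample (F : A.Flag) (i j : Fin n) (h : j ≤ i) : F.cross j < F.sample i := by
  have h1 := F.cross_strictMono.monotone h
  unfold sample
  split_ifs with hi
  · have : F.cross i < F.cross ⟨i.1 + 1, hi⟩ := F.cross_strictMono (Fin.mk_lt_mk.2 (Nat.lt_succ_self _))
    linarith
  · linarith

theorem sample_lt_cross (F : A.Flag) (i j : Fin n) (h : i < j) : F.sample i < F.cross j := by
  have hi : i.1 + 1 < n := lt_of_le_of_lt (Nat.succ_le_of_lt h) j.2
  have h1 : F.cross i < F.cross ⟨i.1 + 1, hi⟩ :=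
    F.cross_strictMono (Fin.mk_lt_mk.2 (Nat.lt_succ_self _))
  have h2 : F.cross ⟨i.1 + 1, hi⟩ ≤ F.cross j :=
    F.cross_strictMono.monotone (Fin.mk_le_of_le_val (Nat.succ_le_of_lt h))
  unfold sample
  rw [dif_pos hi]
  linarith

theorem sample_mem_compl (F : A.Flag) (i : Fin n) : F.pt + F.sample i • F.dir ∈ A.compl := by
  intro j hj
  rw [F.mem_line_iff] at hj
  rcases le_or_gt j i with h | h
  · exact (F.cross_lt_sample i j h).ne' hj
  · exact (F.sample_lt_cross i j h).ne hj

/-- The chamber `C_i` as an element of `ch¹`. -/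
def chamberOne (F : A.Flag) (i : Fin n) : F.ch 1 :=
  ⟨A.chamberAt _ (F.sample_mem_compl i), by
    constructor
    · rw [Set.eq_empty_iff_forall_notMem]
      rintro x ⟨hx, rfl⟩
      have h1 := Chamber.sign _ (A.mem_chamberAt _ (F.sample_mem_compl i)) hx i
      exact lt_asymm ((F.mem_neg_iff i _).1 h1) (F.cross_lt_sample i i le_rfl)
    · exact ⟨_, A.mem_chamberAt _ (F.sample_mem_compl i), F.sample i, rfl⟩⟩

theorem chamberOne_subset_pos (F : A.Flag) (i j : Fin n) (h : j ≤ i) :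
    (F.chamberOne i).1.1 ⊆ F.pos j := by
  intro x hx
  have h1 := Chamber.sign _ (A.mem_chamberAt _ (F.sample_mem_compl i)) hx j
  have h2 := F.mem_pos.1 ((F.mem_pos_iff j _).2 (F.cross_lt_sample i j h))
  show A.form j x * A.form j F.pt < 0
  rcases pos_and_pos_or_neg_and_neg_of_mul_pos h1 with ⟨h3, h4⟩ | ⟨h3, h4⟩
  · exact mul_neg_of_pos_of_neg h4 (neg_of_mul_neg_right h2 h3.le)
  · exact mul_neg_of_neg_of_pos h4 (pos_of_mul_neg_right h2 h3.le)

theorem chamberOne_subset_neg (F : A.Flag) (i j : Fin n) (h : i < j) :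
    (F.chamberOne i).1.1 ⊆ F.neg j := by
  intro x hx
  have h1 := Chamber.sign _ (A.mem_chamberAt _ (F.sample_mem_compl i)) hx j
  have h2 := F.mem_neg.1 ((F.mem_neg_iff j _).2 (F.sample_lt_cross i j h))
  show 0 < A.form j x * A.form j F.pt
  rcases pos_and_pos_or_neg_and_neg_of_mul_pos h1 with ⟨h3, h4⟩ | ⟨h3, h4⟩
  · exact mul_pos h4 (pos_of_mul_pos_right h2 h3.le)
  · exact mul_pos_of_neg_of_neg h4 (neg_of_mul_pos_right h2 h3.le)

theorem chamberOne_bijective (F : A.Flag) : Function.Bijective F.chamberOne := by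
  constructor
  · have key : ∀ i j, F.chamberOne i = F.chamberOne j → ¬ i < j := by
      intro i j hij h
      obtain ⟨x, hx⟩ := (F.chamberOne i).1.nonempty
      have h1 := F.mem_neg.1 (F.chamberOne_subset_neg i j h hx)
      rw [hij] at hx
      have h2 := F.mem_pos.1 (F.chamberOne_subset_pos j j le_rfl hx)
      exact lt_asymm h1 h2
    intro i j hij
    exact le_antisymm (not_lt.1 (key j i hij.symm)) (not_lt.1 (key i j hij))
  · rintro ⟨C, h0, x, hx, t, rfl⟩
    have hx' : F.pt + t • F.dir ∈ C.1 := hx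
    have hne : ∀ j, t ≠ F.cross j := fun j h =>
      C.subset_compl hx' j ((F.mem_line_iff j t).2 h)
    have hT : (Finset.univ.filter fun j => F.cross j < t).Nonempty := by
      by_contra hT
      have hT' : ∀ j, t < F.cross j := fun j => by
        rcases lt_trichotomy t (F.cross j) with h | h | h
        · exact h
        · exact absurd h (hne j)
        · exact absurd ⟨j, by simpa using h⟩ hT
      have hpt : F.pt ∈ A.compl := fun i h => F.form_pt_ne i h
      have hC : C = A.chamberAt F.pt hpt :=
        C.eq_of_sign _ hx' (A.mem_chamberAt _ _) fun i => (F.mem_neg_iff i t).2 (hT' i)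
      have hm : F.pt ∈ C.1 ∩ F.space 1 := ⟨by rw [hC]; exact A.mem_chamberAt _ _, rfl⟩
      rw [h0] at hm
      exact hm
    refine ⟨Finset.max' _ hT, Subtype.ext ?_⟩
    set i := Finset.max' _ hT with hi
    refine Chamber.eq_of_sign _ _ (A.mem_chamberAt _ (F.sample_mem_compl i)) hx' fun j => ?_
    have hiT : F.cross i < t := by
      have := Finset.max'_mem _ hT
      rw [← hi] at this
      simpa using this
    have hpp := mul_self_pos.2 (F.form_pt_ne j)
    rcases le_or_gt j i with h | h
    · have h1 := F.mem_pos.1 ((F.mem_pos_iff j _).2 (F.cross_lt_sample i j h))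
      have h2 := F.mem_pos.1 <|
        (F.mem_pos_iff j t).2 (lt_of_le_of_lt (F.cross_strictMono.monotone h) hiT)
      nlinarith [mul_pos_of_neg_of_neg h1 h2]
    · have h1 := F.mem_neg.1 ((F.mem_neg_iff j _).2 (F.sample_lt_cross i j h))
      have h2 := F.mem_neg.1 <| (F.mem_neg_iff j t).2 (by
        rcases lt_trichotomy t (F.cross j) with h' | h' | h'
        · exact h'
        · exact absurd h' (hne j)
        · exact absurd (Finset.le_max' _ j (by simpa using h')) (not_le.2 h))
      nlinarith [mul_pos h1 h2]

/-- The numbering `C_1, …, C_n` of `ch¹`: by `chamberOne_subset_pos` and `chamberOne_subset_neg`,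
`C_i` is the chamber that lies in `H j ^ +` for `j ≤ i` and in `H j ^ -` for `j > i`. -/
def C (F : A.Flag) : Fin n ≃ F.ch 1 := Equiv.ofBijective F.chamberOne F.chamberOne_bijective

/-- The degree `deg(C_i, D)`. -/
def deg (F : A.Flag) (i : Fin n) (D : A.Chamber) : ℤ :=
  if h : i.1 + 1 < n then
    if D.1 ⊆ F.neg i ∩ F.pos ⟨i.1 + 1, h⟩ then 1
    else if D.1 ⊆ F.pos i ∩ F.neg ⟨i.1 + 1, h⟩ then -1
    else 0
  else if D.1 ⊆ F.pos i then -1 else 0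

section Complex

/-! For a finite set `X`, the free module `R[X]` is the module `X → R`, with the basis
`[x] = Pi.single x 1`. -/

variable {R : Type*} [CommRing R]

/-- The differential `∇ : R[ch⁰] → R[ch¹]` of `η = ∑ a i • e i`. -/
def nabla₀ (F : A.Flag) (a : Fin n → R) : (F.ch 0 → R) →ₗ[R] (F.ch 1 → R) :=
  Fintype.linearCombination R fun C₀ : F.ch 0 =>
    ∑ C : F.ch 1, (∑ i ∈ A.Sep C₀.1 C.1, a i) • Pi.single C (1 : R)

/-- The differential `∇ : R[ch¹] → R[ch²]` of `η = ∑ a i • e i`. -/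
def nabla₁ (F : A.Flag) (a : Fin n → R) : (F.ch 1 → R) →ₗ[R] (F.ch 2 → R) :=
  Fintype.linearCombination R fun C : F.ch 1 =>
    ∑ D : F.ch 2, ((F.deg (F.C.symm C) D.1 : R) * ∑ i ∈ A.Sep C.1 D.1, a i) •
      Pi.single D (1 : R)

/-- `H¹` of the chamber complex: the kernel of `∇ : R[ch¹] → R[ch²]` modulo the image of
`∇ : R[ch⁰] → R[ch¹]`. -/
abbrev H1 (F : A.Flag) (a : Fin n → R) : Type _ :=
  LinearMap.ker (F.nabla₁ a) ⧸
    (LinearMap.range (F.nabla₀ a)).submoduleOf (LinearMap.ker (F.nabla₁ a))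

end Complex

/-- Bands: pairs of consecutive parallel lines `H i`, `H (i+1)`, recorded by `i`. -/
def Band (F : A.Flag) : Type :=
  {i : Fin n // ∃ h : i.1 + 1 < n, A.line i ∩ A.line ⟨i.1 + 1, h⟩ = ∅}

/-- The second of the two lines that bound a band. -/
def Band.next {F : A.Flag} (B : F.Band) : Fin n := ⟨B.1.1 + 1, B.2.1⟩

/-- The open region between the two lines of a band. -/
def Band.region {F : A.Flag} (B : F.Band) : Set (ℝ × ℝ) := F.pos B.1 ∩ F.neg B.next

/-- The unbounded chamber `U₁(B)` of `B` that meets `F¹`. -/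
def Band.U₁ {F : A.Flag} (B : F.Band) : F.ch 1 := F.C B.1

/-- `U₁(B)` lies in `B`, and `U₁(B) ∩ F¹ = B ∩ F¹`. -/
theorem Band.U₁_spec {F : A.Flag} (B : F.Band) :
    B.U₁.1.1 ⊆ B.region ∧ B.U₁.1.1 ∩ F.space 2 = B.region ∩ F.space 2 := by
  have hlt : B.1 < B.next := Fin.mk_lt_mk.2 (Nat.lt_succ_self _)
  have hsub : B.U₁.1.1 ⊆ B.region := fun x hx =>
    ⟨F.chamberOne_subset_pos _ _ le_rfl hx, F.chamberOne_subset_neg _ _ hlt hx⟩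
  refine ⟨hsub, Set.Subset.antisymm (Set.inter_subset_inter_left _ hsub) ?_⟩
  rintro _ ⟨⟨h1, h2⟩, t, rfl⟩
  refine ⟨?_, t, rfl⟩
  have h1' := (F.mem_pos_iff _ t).1 h1
  have h2' := (F.mem_neg_iff _ t).1 h2
  have hle : ∀ j, j ≤ B.1 ∨ B.next ≤ j := fun j => by
    rcases le_or_gt j B.1 with h | h
    · exact Or.inl h
    · exact Or.inr (Fin.mk_le_of_le_val (Nat.succ_le_of_lt h))
  have hc : F.pt + t • F.dir ∈ A.compl := by
    intro j hj
    rw [F.mem_line_iff] at hj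
    rcases hle j with h | h
    · have := F.cross_strictMono.monotone h
      linarith
    · have := F.cross_strictMono.monotone h
      linarith
  have : A.chamberAt _ (F.sample_mem_compl B.1) = A.chamberAt _ hc := by
    refine Chamber.eq_of_sign _ _ (A.mem_chamberAt _ _) (A.mem_chamberAt _ _) fun j => ?_
    have hpp := mul_self_pos.2 (F.form_pt_ne j)
    rcases hle j with h | h
    · have h3 := F.mem_pos.1 ((F.mem_pos_iff j _).2 (F.cross_lt_sample B.1 j h))
      have h4 := F.mem_pos.1 <|
        (F.mem_pos_iff j t).2 (lt_of_le_of_lt (F.cross_strictMono.monotone h) h1')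
      nlinarith [mul_pos_of_neg_of_neg h3 h4]
    · have h3 := F.mem_neg.1 ((F.mem_neg_iff j _).2 (F.sample_lt_cross B.1 j (hlt.trans_le h)))
      have h4 := F.mem_neg.1 <|
        (F.mem_neg_iff j t).2 (lt_of_lt_of_le h2' (F.cross_strictMono.monotone h))
      nlinarith [mul_pos h3 h4]
  show _ ∈ (A.chamberAt _ (F.sample_mem_compl B.1)).1
  rw [this]
  exact A.mem_chamberAt _ hc

section Bands

variable {R : Type*} [CommRing R]

/-- A band is `η`-resonant if `∑ a i = 0` over the lines that separate `U₁(B)` from `U₂(B)`, where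
`U₁(B)` and `U₂(B)` are the unbounded chambers contained in `B`. (When all lines are parallel, `B`
itself is the only such chamber, and `U₂(B) = U₁(B)`.) -/
def Band.IsResonant {F : A.Flag} (a : Fin n → R) (B : F.Band) : Prop :=
  ∃ U₂ : A.Chamber,
    {U : A.Chamber | U.1 ⊆ B.region ∧ ¬ Bornology.IsBounded U.1} = {B.U₁.1, U₂} ∧
      ∑ i ∈ A.Sep B.U₁.1 U₂, a i = 0

/-- The set of `η`-resonant bands. -/
def RB (F : A.Flag) (a : Fin n → R) : Type := {B : F.Band // B.IsResonant a}

instance (F : A.Flag) (a : Fin n → R) : Fintype (F.RB a) :=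
  @Fintype.ofFinite _ (@Subtype.finite _ (Subtype.finite (α := Fin n)) _)

/-- The linear extension `U₁ : R[RB] → R[ch¹]`. -/
def U₁ (F : A.Flag) (a : Fin n → R) : (F.RB a → R) →ₗ[R] (F.ch 1 → R) :=
  Fintype.linearCombination R fun B : F.RB a => Pi.single B.1.U₁ (1 : R)

/-- The map `-∇ ∘ U₁ : R[RB] → R[ch²]`. -/
def nablaTilde (F : A.Flag) (a : Fin n → R) : (F.RB a → R) →ₗ[R] (F.ch 2 → R) :=
  -(F.nabla₁ a ∘ₗ F.U₁ a)

theorem U₁_mem_ker (F : A.Flag) (a : Fin n → R) (x : F.RB a → R)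
    (hx : x ∈ LinearMap.ker (F.nablaTilde a)) : F.U₁ a x ∈ LinearMap.ker (F.nabla₁ a) := by
  simpa [nablaTilde] using hx

/-- The natural map from the kernel of `-∇ ∘ U₁` to `H¹` of the chamber complex, induced by
`U₁`. -/
def U₁Tilde (F : A.Flag) (a : Fin n → R) : LinearMap.ker (F.nablaTilde a) →ₗ[R] F.H1 a :=
  Submodule.mkQ _ ∘ₗ (F.U₁ a).restrict (F.U₁_mem_ker a)

end Bands

end Flag

section OrlikSolomon

variable (R : Type*) [CommRing R]

/-- The monomial `e_S` in the exterior algebra on `e_1, …, e_n`, with increasing factors. -/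
def monomial (S : Finset (Fin n)) : ExteriorAlgebra R (Fin n → R) :=
  ((S.sort (· ≤ ·)).map fun i => ExteriorAlgebra.ι R (Pi.single i (1 : R))).prod

/-- The derivation `∂` of degree `-1` with `∂ e_i = 1`. -/
def boundary : ExteriorAlgebra R (Fin n → R) →ₗ[R] ExteriorAlgebra R (Fin n → R) :=
  CliffordAlgebra.contractLeft (Q := (0 : QuadraticForm R (Fin n → R)))
    (∑ i : Fin n, LinearMap.proj i)

/-- `S` is dependent if its lines have a common point and linearly dependent equations. -/
def Dependent (A : LineArrangement n) (S : Finset (Fin n)) : Prop :=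
  (⋂ i ∈ S, A.line i).Nonempty ∧ ¬ LinearIndependent ℝ fun i : S => A.form i

/-- The relations of the Orlik-Solomon algebra. -/
inductive OSRel (A : LineArrangement n) :
    ExteriorAlgebra R (Fin n → R) → ExteriorAlgebra R (Fin n → R) → Prop
  | empty (S : Finset (Fin n)) (hS : ⋂ i ∈ S, A.line i = ∅) : OSRel A (monomial R S) 0
  | dependent (S : Finset (Fin n)) (hS : A.Dependent S) : OSRel A (boundary R (monomial R S)) 0

/-- The Orlik-Solomon algebra: the quotient of the exterior algebra by the two-sided ideal that the
left hand sides of the relations generate. -/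
abbrev OS (A : LineArrangement n) : Type _ := RingQuot (OSRel R A)

/-- The homogeneous part of degree `p` of the Orlik-Solomon algebra. -/
def osPart (A : LineArrangement n) (p : ℕ) : Submodule R (A.OS R) :=
  (⋀[R]^p (Fin n → R)).map (RingQuot.mkAlgHom R (OSRel R A)).toLinearMap

/-- The generator `e_i` of the Orlik-Solomon algebra. -/
def e (A : LineArrangement n) (i : Fin n) : A.OS R :=
  RingQuot.mkAlgHom R (OSRel R A) (ExteriorAlgebra.ι R (Pi.single i (1 : R)))

variable {R}

/-- The element `η = ∑ a i • e i`. -/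
def eta (A : LineArrangement n) (a : Fin n → R) : A.OS R := ∑ i, a i • A.e R i

/-- The cocycles of degree one in the Aomoto complex. -/
def aomotoZ1 (A : LineArrangement n) (a : Fin n → R) : Submodule R (A.OS R) :=
  A.osPart R 1 ⊓ LinearMap.ker (LinearMap.mulLeft R (A.eta a))

/-- The coboundaries of degree one in the Aomoto complex. -/
def aomotoB1 (A : LineArrangement n) (a : Fin n → R) : Submodule R (A.OS R) :=
  (A.osPart R 0).map (LinearMap.mulLeft R (A.eta a))

/-- `H¹` of the Aomoto complex, with the multiplication by `η` as differential. -/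
abbrev AomotoH1 (A : LineArrangement n) (a : Fin n → R) : Type _ :=
  A.aomotoZ1 a ⧸ (A.aomotoB1 a).submoduleOf (A.aomotoZ1 a)

/-- The map `R[ch¹] → A¹` with `C_i ↦ e_i - e_{i+1}` for `i < n` and `C_n ↦ e_n`. -/
def Flag.phi₁ {A : LineArrangement n} (F : A.Flag) : (F.ch 1 → R) →ₗ[R] A.OS R :=
  Fintype.linearCombination R fun C : F.ch 1 =>
    if h : (F.C.symm C).1 + 1 < n then A.e R (F.C.symm C) - A.e R ⟨(F.C.symm C).1 + 1, h⟩
    else A.e R (F.C.symm C)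

end OrlikSolomon

end

end LineArrangement

/-!
The proof never compares the two complexes in degree two. It shows that in both of them the
cocycles of degree one are given by the same local conditions.

Write a chain of `R[ch¹]` as `∑ x i [C_i]` and put `y i = x i - x (i-1)`, so that `φ₁` sends the
chain to `∑ y i e i` (`Flag.phi₁_partialSums`) and the coboundary of `[C_0]` has `y = a`. Consider
the condition `IsLocalCocycle a y`: for each point `q` of the plane and each line `H i` through `q`,
`(∑ a j) y i = a i (∑ y j)`, where `j` runs over the lines through `q`.

* In the Orlik-Solomon algebra, `η * ∑ y i e i` is the sum over the intersection points `q` of the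
  products of the parts of both factors that live on the lines through `q`; the relations of
  concurrent lines turn such a product into `e i₀ * ∑ ((∑ a j) y k - a k (∑ y j)) e k`. Conversely,
  each local condition is read off from a matrix entry of a small representation of the algebra
  (`exists_representation`). This gives `eta_mul_eq_zero_iff`.
* In the chamber complex, summation by parts shows that the coefficient of `∇` at a chamber `D` is
  minus the sum of `a j y i - a i y j` over the pairs `j < i` for which `D` lies before `H j` and
  after `H i` (`Flag.nabla₁_partialSums`). Take `F¹` as the axis of height zero, such that all
  intersection points have positive height (`Flag.nonempty_coordinates`). The pairs that are
  inverted at a point of `D` are grouped by their crossing points, all of which are lower. The sum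
  over the pairs that cross at `q` vanishes under the local condition at `q`, and conversely the
  local conditions follow from the vanishing of `∇` by induction on the height of `q`
  (`isCocycleAt_of_sum_inversions`). This gives `Flag.nabla₁_partialSums_eq_zero_iff`.

For the statements on `U₁`, let `α = ∑ a i` be a unit. The coefficient of the coboundary of `[C_0]`
at `C_n` is `α`, while `C_n` lies in no band; this gives injectivity, and it shows that every class
has a representative with `∑ y i = 0`. Adding up the local conditions at the points of `H i` gives
`(α - a_B) y i = - a i y_B`, where the subscript `B` denotes the sum over the lines parallel to
`H i`. Summation over this class of parallel lines gives `α y_B = 0`, so `y_B = 0` and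
`(α - a_B) y i = 0`. The classes of parallel lines are intervals of the numbering, because the
slopes are monotone, so `y_B = 0` for all classes means that the chain is supported on bands. Over a
domain, a nonzero coefficient forces `α = a_B`, which says that the band is resonant, as the two
unbounded chambers of a band are separated by exactly the lines not parallel to it
(`Flag.Coordinates.isResonant`).
-/

namespace LineArrangement

noncomputable section

open scoped Classical

variable {n : ℕ}

/-! ### Coordinates adapted to the flag -/

/-- Coordinates `(x, h)` of the plane in which the line `H i` is the graph
`x = cross i + slope i * h`, with its positive side on the right. They arise from the parameter `x`
of `F¹`, which is the axis `h = 0`, and from an orientation of the axis `h` for which all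
intersection points have positive height, that is, for which the slopes decrease. -/
structure Flag.Coordinates {A : LineArrangement n} (F : A.Flag) where
  chart : (ℝ × ℝ) ≃ₜ (ℝ × ℝ)
  slope : Fin n → ℝ
  slope_antitone : Antitone slope
  mem_line : ∀ i z, z ∈ A.line i ↔ F.cross i + slope i * (chart z).2 = (chart z).1
  mem_pos : ∀ i z, z ∈ F.pos i ↔ F.cross i + slope i * (chart z).2 < (chart z).1

theorem form_add (A : LineArrangement n) (i : Fin n) (z v : ℝ × ℝ) :
    A.form i (z + v) = A.form i z + (A.form i).linear v := by
  have := (A.form i).map_vadd z v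
  simp only [vadd_eq_add] at this
  rw [add_comm z, this, add_comm]

namespace Flag

variable {A : LineArrangement n}

/-- The slope of `H i` in the coordinates with axes `dir` and `v`. -/
def slopeAlong (F : A.Flag) (v : ℝ × ℝ) (i : Fin n) : ℝ :=
  F.cross i * (A.form i).linear v / A.form i F.pt

theorem form_coordinates (F : A.Flag) (v : ℝ × ℝ) (i : Fin n) (x h : ℝ) :
    F.cross i * A.form i (F.pt + x • F.dir + h • v)
      = (F.cross i + F.slopeAlong v i * h - x) * A.form i F.pt := by
  have h0 := F.form_pt_ne i
  have h1 := F.form_mul i x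
  rw [form_add, map_smul, smul_eq_mul, mul_add, h1, slopeAlong]
  field_simp
  ring

theorem mem_line_coordinates (F : A.Flag) (v : ℝ × ℝ) (i : Fin n) (x h : ℝ) :
    F.pt + x • F.dir + h • v ∈ A.line i ↔ F.cross i + F.slopeAlong v i * h = x := by
  have h0 := F.form_pt_ne i
  have h1 := F.form_coordinates v i x h
  have hc := F.cross_pos i
  constructor
  · intro hz
    have hz' : A.form i (F.pt + x • F.dir + h • v) = 0 := hz
    rw [hz', mul_zero, eq_comm, mul_eq_zero] at h1
    linarith [h1.resolve_right h0]
  · intro hz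
    rw [hz, sub_self, zero_mul, mul_eq_zero] at h1
    exact h1.resolve_left hc.ne'

theorem mem_pos_coordinates (F : A.Flag) (v : ℝ × ℝ) (i : Fin n) (x h : ℝ) :
    F.pt + x • F.dir + h • v ∈ F.pos i ↔ F.cross i + F.slopeAlong v i * h < x := by
  have h0 : 0 < A.form i F.pt * A.form i F.pt := mul_self_pos.2 (F.form_pt_ne i)
  have h1 := F.form_coordinates v i x h
  have hc := F.cross_pos i
  have key : F.cross i * -(A.form i (F.pt + x • F.dir + h • v) * A.form i F.pt)
      = (x - (F.cross i + F.slopeAlong v i * h)) * (A.form i F.pt * A.form i F.pt) := by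
    linear_combination -(A.form i F.pt) * h1
  rw [pos, Set.mem_ofPred_eq, ← neg_pos, ← mul_pos_iff_of_pos_left hc, key,
    mul_pos_iff_of_pos_right h0, sub_pos]

/-- The intersection points lie on one side of `F¹`, so the slopes are monotone. -/
theorem slopeAlong_monotone_or_antitone (F : A.Flag) (v : ℝ × ℝ) :
    Monotone (F.slopeAlong v) ∨ Antitone (F.slopeAlong v) := by
  by_contra! hcon
  obtain ⟨hm, ha⟩ := hcon
  set m := F.slopeAlong v with hmdef
  obtain ⟨i, j, hij, hi⟩ : ∃ i j, i < j ∧ m j < m i := by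
    by_contra! hh
    exact hm fun i j hij => hij.eq_or_lt.elim (fun h => h ▸ le_rfl) (hh i j)
  obtain ⟨k, l, hkl, hk⟩ : ∃ i j, i < j ∧ m i < m j := by
    by_contra! hh
    exact ha fun i j hij => hij.eq_or_lt.elim (fun h => h ▸ le_rfl) (hh i j)
  have hc1 := F.cross_strictMono hij
  have hc2 := F.cross_strictMono hkl
  have e1 : m i - m j ≠ 0 := by linarith [hi]
  have e2 : m k - m l ≠ 0 := by
    intro h; linarith
  set h1 := (F.cross j - F.cross i) / (m i - m j) with hh1
  set h2 := (F.cross l - F.cross k) / (m k - m l) with hh2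
  have p1 : 0 < h1 := div_pos (by linarith) (by linarith)
  have p2 : h2 < 0 := div_neg_of_pos_of_neg (by linarith) (by linarith)
  have q1 : F.cross j + m j * h1 = F.cross i + m i * h1 := by
    rw [hh1]; field_simp; ring
  have q2 : F.cross l + m l * h2 = F.cross k + m k * h2 := by
    rw [hh2]; field_simp; ring
  have hd := F.not_separates i j k l hij.ne hkl.ne
    (F.pt + (F.cross i + m i * h1) • F.dir + h1 • v)
    ⟨(F.mem_line_coordinates v i _ _).2 rfl, (F.mem_line_coordinates v j _ _).2 q1⟩
    (F.pt + (F.cross k + m k * h2) • F.dir + h2 • v)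
    ⟨(F.mem_line_coordinates v k _ _).2 rfl, (F.mem_line_coordinates v l _ _).2 q2⟩
  -- the point of the segment at height `0`
  refine Set.disjoint_left.1 hd
    ⟨-h2 / (h1 - h2), h1 / (h1 - h2), div_nonneg (by linarith) (by linarith),
      div_nonneg (by linarith) (by linarith), ?_, rfl⟩
    ⟨-h2 / (h1 - h2) * (F.cross i + m i * h1) + h1 / (h1 - h2) * (F.cross k + m k * h2), ?_⟩
  · have : h1 - h2 ≠ 0 := by linarith
    field_simp
    ring
  · have : h1 - h2 ≠ 0 := by linarith
    ext <;> simp <;> field_simp <;> ring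

/-- A second axis for which the slopes decrease: a normal vector of `F¹` or its negative. -/
theorem exists_transversal (F : A.Flag) : ∃ v : ℝ × ℝ,
    F.dir.1 * v.2 - F.dir.2 * v.1 ≠ 0 ∧ Antitone (F.slopeAlong v) := by
  have hN : F.dir.1 * F.dir.1 + F.dir.2 * F.dir.2 ≠ 0 := by
    intro h
    have h1 : F.dir.1 = 0 := by nlinarith [mul_self_nonneg F.dir.1, mul_self_nonneg F.dir.2]
    have h2 : F.dir.2 = 0 := by nlinarith [mul_self_nonneg F.dir.1, mul_self_nonneg F.dir.2]
    exact F.dir_ne_zero (Prod.ext h1 h2)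
  rcases F.slopeAlong_monotone_or_antitone (-F.dir.2, F.dir.1) with h | h
  · refine ⟨-(-F.dir.2, F.dir.1), fun h0 => hN ?_, ?_⟩
    · simp only [Prod.neg_mk, neg_neg] at h0
      linarith
    intro i j hij
    have := h hij
    simp only [slopeAlong, map_neg, mul_neg, neg_div] at this ⊢
    linarith
  · exact ⟨(-F.dir.2, F.dir.1), by simpa using hN, h⟩

theorem nonempty_coordinates (F : A.Flag) : Nonempty F.Coordinates := by
  obtain ⟨v, hv, hm⟩ := F.exists_transversal
  set δ := F.dir.1 * v.2 - F.dir.2 * v.1 with hδ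
  let κ : (ℝ × ℝ) ≃ₜ (ℝ × ℝ) :=
    { toFun := fun z => (((z.1 - F.pt.1) * v.2 - (z.2 - F.pt.2) * v.1) / δ,
        (F.dir.1 * (z.2 - F.pt.2) - F.dir.2 * (z.1 - F.pt.1)) / δ)
      invFun := fun p => F.pt + p.1 • F.dir + p.2 • v
      left_inv := fun z => by
        ext <;> simp <;> field_simp <;> rw [hδ] <;> ring
      right_inv := fun p => by
        ext <;> simp <;> field_simp <;> rw [hδ] <;> ring
      continuous_toFun := by fun_prop
      continuous_invFun := by fun_prop }
  have hκ : ∀ z, z = F.pt + (κ z).1 • F.dir + (κ z).2 • v := fun z => (κ.left_inv z).symm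
  refine ⟨⟨κ, F.slopeAlong v, hm, fun i z => ?_, fun i z => ?_⟩⟩
  · conv_lhs => rw [hκ z]
    exact F.mem_line_coordinates v i _ _
  · conv_lhs => rw [hκ z]
    exact F.mem_pos_coordinates v i _ _

end Flag

/-! ### Sums over inversions of a pencil of graphs -/

section Graphs

/-! The lines are now graphs `x = c i + m i * h` with `c` strictly increasing and `m` decreasing. -/

variable {ι : Type*} (c m : ι → ℝ) {R : Type*} [CommRing R] (a y : ι → R)

/-- The height at which two graphs cross. -/
def crossHeight (p : ι × ι) : ℝ := (c p.2 - c p.1) / (m p.1 - m p.2)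

/-- The point in which two graphs cross. -/
def crossPoint (p : ι × ι) : ℝ × ℝ := (c p.1 + m p.1 * crossHeight c m p, crossHeight c m p)

variable {c m a y} in
theorem crossPoint_eq_iff {p : ι × ι} (hp : m p.1 ≠ m p.2) (x h : ℝ) :
    crossPoint c m p = (x, h) ↔ c p.1 + m p.1 * h = x ∧ c p.2 + m p.2 * h = x := by
  have h0 : m p.1 - m p.2 ≠ 0 := sub_ne_zero.2 hp
  have key : crossHeight c m p = h ↔ c p.1 + m p.1 * h = c p.2 + m p.2 * h := by
    rw [crossHeight, div_eq_iff h0]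
    constructor <;> intro h <;> linarith
  rw [crossPoint, Prod.mk.injEq]
  constructor
  · rintro ⟨h1, h2⟩
    rw [h2] at h1
    exact ⟨h1, (key.1 h2).symm.trans h1⟩
  · rintro ⟨h1, h2⟩
    have h3 := key.2 (h1.trans h2.symm)
    exact ⟨by rw [h3, h1], h3⟩

variable {a y} in
/-- The sum of the coefficients of `(∑ a i e i) (∑ y i e i)` over a rectangle of pairs. -/
theorem sum_product_wedge (U V : Finset ι) :
    ∑ p ∈ V ×ˢ U, (a p.1 * y p.2 - a p.2 * y p.1) =
      (∑ j ∈ V, a j) * ∑ i ∈ U, y i - (∑ i ∈ U, a i) * ∑ j ∈ V, y j := by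
  rw [Finset.sum_product, Finset.sum_mul_sum, Finset.sum_mul_sum, Finset.sum_comm (s := U)]
  simp_rw [← Finset.sum_sub_distrib]

/-- A sum vanishes if its parts over the nonempty fibers of some map vanish. -/
theorem sum_eq_zero_of_fiberwise {α β M : Type*} [DecidableEq β] [AddCommMonoid M]
    (s : Finset α) (g : α → β) (f : α → M) (h : ∀ p ∈ s, ∑ q ∈ s with g q = g p, f q = 0) : ∑ p ∈ s, f p = 0 := by
  rw [← Finset.sum_fiberwise_of_maps_to (t := s.image g) (g := g)
    fun p hp => Finset.mem_image_of_mem g hp]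
  refine Finset.sum_eq_zero fun b hb => ?_
  obtain ⟨p, hp, rfl⟩ := Finset.mem_image.1 hb
  exact h p hp

variable [Fintype ι]

/-- The graphs that pass through the point `(x, h)`. -/
def graphsThrough (x h : ℝ) : Finset ι := {i | c i + m i * h = x}

/-- The condition that `(∑ a i e i) (∑ y i e i)` vanishes locally at the point `(x, h)`. -/
def IsCocycleAt (x h : ℝ) : Prop :=
  ∀ i, c i + m i * h = x →
    (∑ j ∈ graphsThrough c m x h, a j) * y i = a i * ∑ j ∈ graphsThrough c m x h, y j

variable {c m a y} in
/-- The pairs of graphs through `(x, h)` that a predicate separates contribute zero in total. -/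
theorem IsCocycleAt.sum_mul {x h : ℝ} (H : IsCocycleAt c m a y x h) (P : ι → Prop) :
    (∑ j ∈ graphsThrough c m x h, a j) * ∑ i ∈ graphsThrough c m x h with P i, y i =
      (∑ i ∈ graphsThrough c m x h with P i, a i) * ∑ j ∈ graphsThrough c m x h, y j := by
  rw [Finset.mul_sum, Finset.sum_mul]
  refine Finset.sum_congr rfl fun i hi => H i ?_
  simpa [graphsThrough] using (Finset.mem_filter.1 hi).1

variable [LinearOrder ι]

/-- The pairs of graphs that are inverted at `(x, h)`: the second one is on the left of `(x, h)`
and the first one on its right, against their order at height `0`. -/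
def inversions (x h : ℝ) : Finset (ι × ι) :=
  {p | p.1 < p.2 ∧ c p.2 + m p.2 * h < x ∧ x < c p.1 + m p.1 * h}

variable {c m a y}

theorem slope_lt_of_mem_inversions (hc : StrictMono c) (hm : Antitone m) {x h : ℝ} {p : ι × ι}
    (hp : p ∈ inversions c m x h) : m p.2 < m p.1 := by
  simp only [inversions, Finset.mem_filter, Finset.mem_univ, true_and] at hp
  refine lt_of_le_of_ne (hm hp.1.le) fun he => ?_
  have := hc hp.1
  have h1 := hp.2.1.trans hp.2.2
  rw [he] at h1
  linarith

theorem crossHeight_lt_of_mem_inversions (hc : StrictMono c) (hm : Antitone m) {x h : ℝ}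
    {p : ι × ι} (hp : p ∈ inversions c m x h) : crossHeight c m p < h := by
  have h1 := slope_lt_of_mem_inversions hc hm hp
  simp only [inversions, Finset.mem_filter, Finset.mem_univ, true_and] at hp
  rw [crossHeight, div_lt_iff₀ (by linarith)]
  linarith [hp.2.1, hp.2.2]

/-- Above their common point `(x', h')`, a graph on the left of `(x, h)` and one on its right are
always inverted. -/
theorem inversions_filter_crossPoint (hc : StrictMono c) (hm : Antitone m) {x h x' h' : ℝ}
    (hh : h' < h) (hx : ∀ i, c i + m i * h ≠ x) :
    {p ∈ inversions c m x h | crossPoint c m p = (x', h')} =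
      {j ∈ graphsThrough c m x' h' | ¬ c j + m j * h < x} ×ˢ
        {i ∈ graphsThrough c m x' h' | c i + m i * h < x} := by
  ext p
  rw [Finset.mem_filter]
  constructor
  · rintro ⟨h1, h2⟩
    rw [crossPoint_eq_iff (slope_lt_of_mem_inversions hc hm h1).ne'] at h2
    simp only [inversions, Finset.mem_filter, Finset.mem_univ, true_and] at h1
    simp only [graphsThrough, Finset.mem_product, Finset.mem_filter, Finset.mem_univ, true_and]
    exact ⟨⟨h2.1, h1.2.2.not_gt⟩, h2.2, h1.2.1⟩
  · simp only [graphsThrough, Finset.mem_product, Finset.mem_filter, Finset.mem_univ, true_and]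
    rintro ⟨⟨h1, h2⟩, h3, h4⟩
    have h2' : x < c p.1 + m p.1 * h := lt_of_le_of_ne (not_lt.1 h2) (hx p.1).symm
    have hlt : m p.2 < m p.1 := by
      by_contra! hle
      nlinarith
    have hi : p ∈ inversions c m x h := by
      simp only [inversions, Finset.mem_filter, Finset.mem_univ, true_and]
      refine ⟨lt_of_not_ge fun hle => ?_, h4, h2'⟩
      exact (hm hle).not_gt hlt
    exact ⟨hi, (crossPoint_eq_iff hlt.ne' _ _).2 ⟨h1, h3⟩⟩

/-- The inversions at `(x, h)` that come from the point `(x', h')` below it, in terms of the graphs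
through `(x', h')` and of those among them on the left of `(x, h)`. -/
theorem sum_inversions_crossPoint (hc : StrictMono c) (hm : Antitone m) {x h x' h' : ℝ}
    (hh : h' < h) (hx : ∀ i, c i + m i * h ≠ x) :
    ∑ p ∈ inversions c m x h with crossPoint c m p = (x', h'), (a p.1 * y p.2 - a p.2 * y p.1) =
      (∑ j ∈ graphsThrough c m x' h', a j) *
          ∑ i ∈ graphsThrough c m x' h' with c i + m i * h < x, y i -
        (∑ i ∈ graphsThrough c m x' h' with c i + m i * h < x, a i) *
          ∑ j ∈ graphsThrough c m x' h', y j := by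
  rw [inversions_filter_crossPoint hc hm hh hx, sum_product_wedge,
    ← Finset.sum_filter_add_sum_filter_not (graphsThrough c m x' h') (fun i => c i + m i * h < x) a,
    ← Finset.sum_filter_add_sum_filter_not (graphsThrough c m x' h') (fun i => c i + m i * h < x) y]
  ring

theorem sum_inversions_crossPoint_eq_zero (hc : StrictMono c) (hm : Antitone m) {x h : ℝ}
    (hx : ∀ i, c i + m i * h ≠ x) {p : ι × ι} (hp : p ∈ inversions c m x h)
    (H : IsCocycleAt c m a y (crossPoint c m p).1 (crossPoint c m p).2) :
    ∑ q ∈ inversions c m x h with crossPoint c m q = crossPoint c m p,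
      (a q.1 * y q.2 - a q.2 * y q.1) = 0 :=
  (sum_inversions_crossPoint hc hm (crossHeight_lt_of_mem_inversions hc hm hp) hx).trans
    (sub_eq_zero.2 (H.sum_mul _))

theorem sum_inversions_eq_zero (hc : StrictMono c) (hm : Antitone m)
    (H : ∀ x h, IsCocycleAt c m a y x h) {x h : ℝ} (hx : ∀ i, c i + m i * h ≠ x) :
    ∑ p ∈ inversions c m x h, (a p.1 * y p.2 - a p.2 * y p.1) = 0 :=
  sum_eq_zero_of_fiberwise _ (crossPoint c m) _ fun _ hp =>
    sum_inversions_crossPoint_eq_zero hc hm hx hp (H _ _)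

/-- Just above the height `h`, no two graphs cross, and their order is compatible with the one at
height `h`. -/
theorem exists_height_above (hc : StrictMono c) (h : ℝ) : ∃ h' > h,
    (∀ j k, j ≠ k → c j + m j * h' ≠ c k + m k * h') ∧
    (∀ j k, c j + m j * h' < c k + m k * h' → c j + m j * h ≤ c k + m k * h) ∧
    ∀ p, crossHeight c m p < h' → crossHeight c m p ≤ h := by
  have e1 : ∀ᶠ h' in nhdsWithin h (Set.Ioi h), ∀ j k, c j + m j * h' < c k + m k * h' →
      c j + m j * h ≤ c k + m k * h := by
    refine Filter.eventually_all.2 fun j => Filter.eventually_all.2 fun k => ?_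
    by_cases hle : c j + m j * h ≤ c k + m k * h
    · exact Filter.Eventually.of_forall fun _ _ => hle
    · have h1 : ∀ᶠ h' in nhds h, c k + m k * h' < c j + m j * h' :=
        ContinuousAt.eventually_lt (by fun_prop) (by fun_prop) (not_le.1 hle)
      filter_upwards [nhdsWithin_le_nhds h1] with h' h1 h2
      exact absurd h1 h2.not_gt
  have e2 : ∀ᶠ h' in nhdsWithin h (Set.Ioi h), ∀ p : ι × ι,
      crossHeight c m p < h' → crossHeight c m p ≤ h := by
    refine Filter.eventually_all.2 fun p => ?_
    by_cases hle : crossHeight c m p ≤ h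
    · exact Filter.Eventually.of_forall fun _ _ => hle
    · filter_upwards [nhdsWithin_le_nhds (eventually_lt_nhds (not_le.1 hle))] with h' h1 h2
      exact absurd h1 h2.not_gt
  have e3 : ∀ᶠ h' in nhdsWithin h (Set.Ioi h), ∀ p : ι × ι, crossHeight c m p ≠ h' := by
    refine Filter.eventually_all.2 fun p => ?_
    by_cases hle : crossHeight c m p ≤ h
    · filter_upwards [self_mem_nhdsWithin] with h' h1
      exact (lt_of_le_of_lt hle h1).ne
    · filter_upwards [nhdsWithin_le_nhds (eventually_lt_nhds (not_le.1 hle))] with h' h1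
      exact h1.ne'
  obtain ⟨h', h1, h2, h3, h4⟩ := (e1.and (e2.and (e3.and self_mem_nhdsWithin))).exists
  refine ⟨h', h4, fun j k hjk he => ?_, h1, h2⟩
  have hne : m j ≠ m k := fun hjk' => hjk (hc.injective (by rw [hjk'] at he; linarith))
  have := (crossPoint_eq_iff (c := c) (p := (j, k)) hne _ h').2 ⟨rfl, he.symm⟩
  exact h3 (j, k) (congrArg Prod.snd this)

/-- The converse of `sum_inversions_eq_zero`. A lowest point at which the cocycle condition fails
is isolated by looking just above it, immediately to the left and to the right of one graph. -/
theorem isCocycleAt_of_sum_inversions (hc : StrictMono c) (hm : Antitone m)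
    (H : ∀ x h, (∀ i, c i + m i * h ≠ x) →
      ∑ p ∈ inversions c m x h, (a p.1 * y p.2 - a p.2 * y p.1) = 0) (x h : ℝ) :
    IsCocycleAt c m a y x h := by
  -- a point at which the condition fails is on two graphs
  have hcross : ∀ x h, ¬ IsCocycleAt c m a y x h →
      ∃ p : ι × ι, m p.1 ≠ m p.2 ∧ crossPoint c m p = (x, h) := by
    intro x h hbad
    simp only [IsCocycleAt, not_forall] at hbad
    obtain ⟨i, hi, hbad⟩ := hbad
    obtain ⟨j, hj, hji⟩ : ∃ j ∈ graphsThrough c m x h, j ≠ i := by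
      by_contra! hall
      have : graphsThrough c m x h = {i} := by
        ext j
        rw [Finset.mem_singleton]
        exact ⟨hall j, fun h => by simpa [graphsThrough, h] using hi⟩
      simp [this] at hbad
    have hj' : c j + m j * h = x := by simpa [graphsThrough] using hj
    have hne : m i ≠ m j := fun he => hji (hc.injective (by rw [he] at hi; linarith))
    exact ⟨(i, j), hne, (crossPoint_eq_iff (p := (i, j)) hne _ _).2 ⟨hi, hj'⟩⟩
  by_contra hbad
  let S : Finset (ι × ι) :=
    {p | ¬ IsCocycleAt c m a y (crossPoint c m p).1 (crossPoint c m p).2}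
  have hS : S.Nonempty := by
    obtain ⟨p, -, hp⟩ := hcross x h hbad
    exact ⟨p, by simpa [S, hp] using hbad⟩
  obtain ⟨p₀, hp₀, hmin⟩ := S.exists_min_image (crossHeight c m) hS
  obtain ⟨x₀, h₀, hxh⟩ : ∃ x₀ h₀, crossPoint c m p₀ = (x₀, h₀) := ⟨_, _, rfl⟩
  have hbad₀ : ¬ IsCocycleAt c m a y x₀ h₀ := by simpa [S, hxh] using hp₀
  have hgood : ∀ x h, h < h₀ → IsCocycleAt c m a y x h := by
    intro x h hlt
    by_contra hb
    obtain ⟨p, -, hp⟩ := hcross x h hb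
    have h1 := hmin p (by simpa [S, hp] using hb)
    have h2 : crossHeight c m p₀ = h₀ := congrArg Prod.snd hxh
    have h3 : crossHeight c m p = h := congrArg Prod.snd hp
    linarith
  refine hbad₀ fun i hi => ?_
  obtain ⟨h', hh', hne, hord, hht⟩ := exists_height_above (m := m) hc h₀
  -- a point at height `h'` near the graph `i` sees the graphs through `(x₀, h₀)` only
  have key : ∀ x', (∀ k, c k + m k * h' ≠ x') →
      (∀ k, c k + m k * h' < x' → c k + m k * h' ≤ c i + m i * h') →
      (∀ k, x' < c k + m k * h' → c i + m i * h' ≤ c k + m k * h') →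
      (∑ j ∈ graphsThrough c m x₀ h₀, a j) *
          ∑ k ∈ graphsThrough c m x₀ h₀ with c k + m k * h' < x', y k =
        (∑ k ∈ graphsThrough c m x₀ h₀ with c k + m k * h' < x', a k) *
          ∑ j ∈ graphsThrough c m x₀ h₀, y j := by
    intro x' hx' hl hr
    rw [← sub_eq_zero, ← sum_inversions_crossPoint hc hm hh' hx', ← H x' h' hx',
      ← Finset.sum_filter_add_sum_filter_not (inversions c m x' h')
        (fun p => crossPoint c m p = (x₀, h₀)), left_eq_add]
    refine sum_eq_zero_of_fiberwise _ (crossPoint c m) _ fun p hp => ?_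
    rw [Finset.mem_filter] at hp
    have hfil : {q ∈ {p ∈ inversions c m x' h' | ¬ crossPoint c m p = (x₀, h₀)} |
        crossPoint c m q = crossPoint c m p} =
        {q ∈ inversions c m x' h' | crossPoint c m q = crossPoint c m p} := by
      rw [Finset.filter_filter]
      refine Finset.filter_congr fun q _ => ⟨And.right, fun h => ⟨h ▸ hp.2, h⟩⟩
    rw [hfil]
    refine sum_inversions_crossPoint_eq_zero hc hm hx' hp.1 (hgood _ _ ?_)
    show crossHeight c m p < h₀
    refine lt_of_le_of_ne (hht p (crossHeight_lt_of_mem_inversions hc hm hp.1)) fun he => hp.2 ?_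
    have hsl := (slope_lt_of_mem_inversions hc hm hp.1).ne'
    have h1 := (crossPoint_eq_iff hsl _ h₀).1 (Prod.ext rfl he)
    have h2 := hp.1
    simp only [inversions, Finset.mem_filter, Finset.mem_univ, true_and] at h2
    have hle : ∀ j k, c j + m j * h' ≤ c k + m k * h' → c j + m j * h₀ ≤ c k + m k * h₀ := by
      intro j k hjk
      by_cases hjk' : j = k
      · rw [hjk']
      · exact hord j k (lt_of_le_of_ne hjk (hne j k hjk'))
    have h3 := hle _ _ (hl _ h2.2.1)
    have h4 := hle _ _ (hr _ h2.2.2)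
    rw [crossPoint_eq_iff hsl]
    constructor <;> linarith [h1.1, h1.2]
  -- points to the left and to the right of the graph `i`, closer than the other graphs
  obtain ⟨δ, hδ, hδ'⟩ : ∃ δ > 0, ∀ k, k ≠ i → δ < |c k + m k * h' - (c i + m i * h')| := by
    have e : ∀ᶠ δ in nhdsWithin (0 : ℝ) (Set.Ioi 0), ∀ k, k ≠ i →
        δ < |c k + m k * h' - (c i + m i * h')| := by
      refine Filter.eventually_all.2 fun k => ?_
      by_cases hk : k = i
      · exact Filter.Eventually.of_forall fun _ h => absurd hk h
      · filter_upwards [nhdsWithin_le_nhds (eventually_lt_nhds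
          (abs_pos.2 (sub_ne_zero.2 (hne k i hk))))] with δ h1 _
        exact h1
    obtain ⟨δ, h1, h2⟩ := (e.and self_mem_nhdsWithin).exists
    exact ⟨δ, h2, h1⟩
  have hside : ∀ k, k = i ∨ c k + m k * h' < c i + m i * h' - δ ∨
      c i + m i * h' + δ < c k + m k * h' := by
    intro k
    by_cases hk : k = i
    · exact Or.inl hk
    · have := hδ' k hk
      rw [lt_abs] at this
      rcases this with h | h
      · exact Or.inr (Or.inr (by linarith))
      · exact Or.inr (Or.inl (by linarith))
  have hleft := key (c i + m i * h' - δ)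
    (fun k he => by rcases hside k with rfl | h | h <;> linarith)
    (fun k he => by linarith)
    (fun k he => by rcases hside k with rfl | h | h <;> linarith)
  have hright := key (c i + m i * h' + δ)
    (fun k he => by rcases hside k with rfl | h | h <;> linarith)
    (fun k he => by rcases hside k with rfl | h | h <;> linarith)
    (fun k he => by linarith)
  have hins : {k ∈ graphsThrough c m x₀ h₀ | c k + m k * h' < c i + m i * h' + δ} =
      insert i {k ∈ graphsThrough c m x₀ h₀ | c k + m k * h' < c i + m i * h' - δ} := by
    ext k
    rw [Finset.mem_insert, Finset.mem_filter, Finset.mem_filter]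
    constructor
    · rintro ⟨h1, h2⟩
      rcases hside k with h | h | h
      · exact Or.inl h
      · exact Or.inr ⟨h1, h⟩
      · linarith
    · rintro (rfl | ⟨h1, h2⟩)
      · exact ⟨by simpa [graphsThrough] using hi, by linarith⟩
      · exact ⟨h1, by linarith⟩
  have hnot : i ∉ {k ∈ graphsThrough c m x₀ h₀ | c k + m k * h' < c i + m i * h' - δ} := by
    rw [Finset.mem_filter]
    rintro ⟨-, h⟩
    linarith
  rw [hins, Finset.sum_insert hnot, Finset.sum_insert hnot] at hright
  linear_combination hright - hleft

/-- Summation by parts: the coefficient of `∇` at a chamber whose sign vector is `s`, in terms of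
`a` and of the differences `y` of the coefficients of the argument. The general `N` and `K` make
the identity amenable to induction on `N`. -/
theorem sum_by_parts (a y s : ℕ → R) (hs : ∀ k, s k * s k = s k) (K : R) (N : ℕ) :
    ∑ i ∈ Finset.range N, (∑ j ∈ Finset.range (i + 1), y j) * (s (i + 1) - s i) *
        (K + ∑ j ∈ Finset.range (i + 1), (1 - 2 * s j) * a j) +
      ∑ i ∈ Finset.range N, ∑ j ∈ Finset.range i, s i * (1 - s j) * (a j * y i - a i * y j) =
    s N * (∑ j ∈ Finset.range N, y j) *
        (K + ∑ j ∈ Finset.range N, a j - 2 * ∑ j ∈ Finset.range N, s j * a j) -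
      (∑ j ∈ Finset.range N, s j * y j) * (K - ∑ j ∈ Finset.range N, s j * a j) := by
  induction N with
  | zero => simp
  | succ N ih =>
    have e1 : ∑ j ∈ Finset.range N, s N * (1 - s j) * (a j * y N - a N * y j) =
        s N * (y N * (∑ j ∈ Finset.range N, a j - ∑ j ∈ Finset.range N, s j * a j) -
          a N * (∑ j ∈ Finset.range N, y j - ∑ j ∈ Finset.range N, s j * y j)) := by
      simp only [← Finset.sum_sub_distrib, Finset.mul_sum]
      exact Finset.sum_congr rfl fun j _ => by ring
    have e2 : ∑ j ∈ Finset.range N, (1 - 2 * s j) * a j =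
        ∑ j ∈ Finset.range N, a j - 2 * ∑ j ∈ Finset.range N, s j * a j := by
      simp only [← Finset.sum_sub_distrib, Finset.mul_sum]
      exact Finset.sum_congr rfl fun j _ => by ring
    rw [Finset.sum_range_succ, Finset.sum_range_succ (fun i => ∑ j ∈ Finset.range i, _), e1]
    simp only [Finset.sum_range_succ _ N, e2]
    linear_combination ih + (2 * a N * (∑ j ∈ Finset.range N, y j) + a N * y N) * hs N

end Graphs

/-! ### The chamber complex in terms of differences of coefficients -/

/-- A function on `Fin n`, extended by zero to the natural numbers. -/
def extendZero {M : Type*} [Zero M] (f : Fin n → M) (k : ℕ) : M :=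
  if h : k < n then f ⟨k, h⟩ else 0

@[simp]
theorem extendZero_val {M : Type*} [Zero M] (f : Fin n → M) (i : Fin n) :
    extendZero f i = f i := dif_pos i.2

theorem sum_Iic_eq_sum_range {M : Type*} [AddCommMonoid M] (f : ℕ → M) (i : Fin n) :
    ∑ j ∈ Finset.Iic i, f j = ∑ k ∈ Finset.range (i.1 + 1), f k := by
  rw [Nat.range_succ_eq_Iic, ← Fin.map_valEmbedding_Iic, Finset.sum_map]
  rfl

theorem sum_Iio_eq_sum_range {M : Type*} [AddCommMonoid M] (f : ℕ → M) (i : Fin n) :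
    ∑ j ∈ Finset.Iio i, f j = ∑ k ∈ Finset.range i.1, f k := by
  rw [← Nat.Iio_eq_range, ← Fin.map_valEmbedding_Iio, Finset.sum_map]
  rfl

namespace Flag

variable {A : LineArrangement n} (F : A.Flag)

theorem notMem_pos_iff {z : ℝ × ℝ} (hz : z ∈ A.compl) (i : Fin n) : z ∉ F.pos i ↔ z ∈ F.neg i := by
  have h1 : A.form i z ≠ 0 := hz i
  have h2 := mul_ne_zero h1 (F.form_pt_ne i)
  rw [mem_pos, mem_neg, not_lt, le_iff_lt_or_eq, or_iff_left h2.symm]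

theorem mem_pos_iff_of_mem_chamber {D : A.Chamber} {w z : ℝ × ℝ} (hw : w ∈ D.1) (hz : z ∈ D.1)
    (i : Fin n) : w ∈ F.pos i ↔ z ∈ F.pos i := by
  have h := D.sign hw hz i
  have hp := mul_self_pos.2 (F.form_pt_ne i)
  rw [mem_pos, mem_pos]
  constructor <;> intro h1 <;> by_contra! h2 <;> nlinarith

theorem subset_pos_iff {D : A.Chamber} {z : ℝ × ℝ} (hz : z ∈ D.1) (i : Fin n) :
    D.1 ⊆ F.pos i ↔ z ∈ F.pos i :=
  ⟨fun h => h hz, fun h _ hw => (F.mem_pos_iff_of_mem_chamber hw hz i).2 h⟩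

theorem subset_neg_iff {D : A.Chamber} {z : ℝ × ℝ} (hz : z ∈ D.1) (i : Fin n) :
    D.1 ⊆ F.neg i ↔ z ∉ F.pos i := by
  rw [F.notMem_pos_iff (D.subset_compl hz)]
  refine ⟨fun h => h hz, fun h w hw => ?_⟩
  rw [← F.notMem_pos_iff (D.subset_compl hz)] at h
  rwa [← F.notMem_pos_iff (D.subset_compl hw), F.mem_pos_iff_of_mem_chamber hw hz]

theorem mem_Sep_iff {C D : A.Chamber} {w z : ℝ × ℝ} (hw : w ∈ C.1) (hz : z ∈ D.1) (i : Fin n) :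
    i ∈ A.Sep C D ↔ ¬ (w ∈ F.pos i ↔ z ∈ F.pos i) := by
  have hp := mul_self_pos.2 (F.form_pt_ne i)
  have key : ∀ w ∈ C.1, ∀ z ∈ D.1,
      (A.form i w * A.form i z < 0 ↔ ¬ (w ∈ F.pos i ↔ z ∈ F.pos i)) := by
    intro w hw z hz
    have h1 : A.form i w ≠ 0 := C.subset_compl hw i
    have h2 : A.form i z ≠ 0 := D.subset_compl hz i
    have h3 := F.form_pt_ne i
    simp only [mem_pos, mul_neg_iff]
    rcases h1.lt_or_gt with h1 | h1 <;> rcases h2.lt_or_gt with h2 | h2 <;>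
      rcases h3.lt_or_gt with h3 | h3 <;> simp [h1, h2, h3, h1.not_gt, h2.not_gt, h3.not_gt]
  rw [← key w hw z hz]
  simp only [Sep, Finset.mem_filter, Finset.mem_univ, true_and]
  refine ⟨fun h => h w hw z hz, fun h w' hw' z' hz' => ?_⟩
  rw [key w hw z hz] at h
  rwa [key w' hw' z' hz', F.mem_pos_iff_of_mem_chamber hw' hw, F.mem_pos_iff_of_mem_chamber hz' hz]

theorem C_subset_pos_iff (i j : Fin n) {w : ℝ × ℝ} (hw : w ∈ (F.C i).1.1) :
    w ∈ F.pos j ↔ j ≤ i := by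
  constructor
  · intro h
    by_contra! hlt
    exact (F.notMem_pos_iff ((F.C i).1.subset_compl hw) j).2 (F.chamberOne_subset_neg i j hlt hw) h
  · exact fun h => F.chamberOne_subset_pos i j h hw

variable {R : Type*} [CommRing R]

/-- The linear map onto `R[ch¹]` under which `φ₁` becomes `y ↦ ∑ y i • e i`: the
coefficient at `C_i` is `∑ y j` over `j ≤ i`. -/
def partialSums : (Fin n → R) →ₗ[R] (F.ch 1 → R) where
  toFun y C := ∑ j ∈ Finset.Iic (F.C.symm C), y j
  map_add' y z := by ext; simp [Finset.sum_add_distrib]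
  map_smul' r y := by ext; simp [Finset.mul_sum]

theorem partialSums_C (y : Fin n → R) (i : Fin n) :
    F.partialSums y (F.C i) = ∑ j ∈ Finset.range (i.1 + 1), extendZero y j := by
  rw [← sum_Iic_eq_sum_range]
  simp [partialSums]

theorem partialSums_surjective : Function.Surjective (F.partialSums (R := R)) := by
  intro x
  let X : ℕ → R := fun k => if k = 0 then 0 else extendZero (fun i => x (F.C i)) (k - 1)
  refine ⟨fun i => X (i.1 + 1) - X i.1, ?_⟩
  ext C
  obtain ⟨i, rfl⟩ := F.C.surjective C
  rw [partialSums, LinearMap.coe_mk, AddHom.coe_mk, Equiv.symm_apply_apply,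
    sum_Iic_eq_sum_range (fun k => X (k + 1) - X k), Finset.sum_range_sub]
  simp [X]

theorem sum_Sep_C (a : Fin n → R) (i : Fin n) {D : A.Chamber} {z : ℝ × ℝ} (hz : z ∈ D.1) :
    ∑ j ∈ A.Sep (F.C i).1 D, a j =
      ∑ j, (if z ∈ F.pos j then 1 else 0) * a j +
        ∑ j ∈ Finset.Iic i, (1 - 2 * (if z ∈ F.pos j then 1 else 0)) * a j := by
  obtain ⟨w, hw⟩ := (F.C i).1.nonempty
  have h1 : ∑ j ∈ A.Sep (F.C i).1 D, a j = ∑ j, if j ∈ A.Sep (F.C i).1 D then a j else 0 := by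
    simp
  have h2 : ∀ f : Fin n → R, ∑ j ∈ Finset.Iic i, f j = ∑ j, if j ≤ i then f j else 0 := fun f => by
    simp [← Finset.mem_Iic]
  rw [h1, h2, ← Finset.sum_add_distrib]
  refine Finset.sum_congr rfl fun j _ => ?_
  simp only [F.mem_Sep_iff hw hz, F.C_subset_pos_iff i j hw]
  by_cases hj : j ≤ i <;> by_cases hp : z ∈ F.pos j <;> simp [hj, hp]
  ring

/-- The degree is a difference of consecutive entries of the sign vector of the chamber. -/
theorem deg_eq (i : Fin n) {D : A.Chamber} {z : ℝ × ℝ} (hz : z ∈ D.1) :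
    (F.deg i D : R) = extendZero (fun j => if z ∈ F.pos j then (1 : R) else 0) (i.1 + 1) -
      if z ∈ F.pos i then 1 else 0 := by
  simp only [deg, Set.subset_inter_iff, F.subset_pos_iff hz, F.subset_neg_iff hz, extendZero]
  split_ifs <;> simp_all

/-- The differential as a sum over the pairs of lines that are inverted at a chamber. -/
theorem nabla₁_partialSums (a y : Fin n → R) (D : F.ch 2) {z : ℝ × ℝ} (hz : z ∈ D.1.1) :
    F.nabla₁ a (F.partialSums y) D =
      -∑ p : Fin n × Fin n with p.1 < p.2 ∧ z ∈ F.pos p.2 ∧ z ∉ F.pos p.1,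
        (a p.1 * y p.2 - a p.2 * y p.1) := by
  let s : ℕ → R := extendZero fun j => if z ∈ F.pos j then (1 : R) else 0
  have hs : ∀ k, s k * s k = s k := by
    intro k
    simp only [s, extendZero]
    split_ifs <;> simp
  have hs' : ∀ j : Fin n, s j = if z ∈ F.pos j then (1 : R) else 0 := fun j => extendZero_val _ j
  have h1 : F.nabla₁ a (F.partialSums y) D = ∑ i : Fin n,
      F.partialSums y (F.C i) * ((F.deg i D.1 : R) * ∑ j ∈ A.Sep (F.C i).1 D.1, a j) := by
    rw [nabla₁, Fintype.linearCombination_apply, Finset.sum_apply, ← F.C.sum_comp]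
    refine Finset.sum_congr rfl fun i _ => ?_
    rw [Pi.smul_apply, Finset.sum_apply, smul_eq_mul]
    simp [Pi.single_apply]
  have h2 := sum_by_parts (extendZero a) (extendZero y) s hs
    (∑ j ∈ Finset.range n, s j * extendZero a j) n
  have hsn : s n = 0 := by simp [s, extendZero]
  rw [hsn, sub_self, mul_zero, zero_mul, zero_mul, sub_self] at h2
  rw [eq_neg_iff_add_eq_zero, h1, ← h2, Finset.sum_range, Finset.sum_range]
  congr 1
  · refine Finset.sum_congr rfl fun i _ => ?_
    rw [partialSums_C, F.sum_Sep_C a i hz, F.deg_eq i hz, mul_assoc, hs',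
      ← sum_Iic_eq_sum_range (fun j => (1 - 2 * s j) * extendZero a j), Finset.sum_range]
    simp only [hs', extendZero_val]
    rfl
  · rw [Finset.sum_filter, ← Finset.univ_product_univ, Finset.sum_product_right, Finset.sum_range]
    refine Finset.sum_congr rfl fun i _ => ?_
    have h3 : ∀ f : Fin n → R, ∑ j ∈ Finset.Iio i, f j = ∑ j, if j < i then f j else 0 :=
      fun f => by simp [← Finset.mem_Iio]
    rw [← sum_Iio_eq_sum_range
      (fun j => s i * (1 - s j) * (extendZero a j * extendZero y i - extendZero a i * extendZero y j)),
      h3]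
    refine Finset.sum_congr rfl fun j _ => ?_
    simp only [hs', extendZero_val]
    by_cases hj : j < i <;> by_cases hi : z ∈ F.pos i <;> by_cases hp : z ∈ F.pos j <;>
      simp [hj, hi, hp]

/-- The coboundary of the only chamber of `ch⁰` corresponds to `η`. -/
theorem nabla₀_eq (a : Fin n → R) (x : F.ch 0 → R) :
    F.nabla₀ a x = (∑ C, x C) • F.partialSums a := by
  rw [nabla₀, Fintype.linearCombination_apply, Finset.sum_smul]
  refine Finset.sum_congr rfl fun C₀ _ => ?_
  congr 1
  have hpt : F.pt ∈ C₀.1.1 := by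
    obtain ⟨z, hz, rfl⟩ := C₀.2.2
    exact hz
  ext C
  obtain ⟨i, rfl⟩ := F.C.surjective C
  rw [Finset.sum_apply]
  simp only [Pi.smul_apply, Pi.single_apply, smul_eq_mul, mul_ite, mul_one, mul_zero,
    Finset.sum_ite_eq, Finset.mem_univ, if_true, partialSums, LinearMap.coe_mk, AddHom.coe_mk,
    Equiv.symm_apply_apply]
  refine Finset.sum_congr ?_ fun _ _ => rfl
  ext j
  obtain ⟨w, hw⟩ := (F.C i).1.nonempty
  have h0 : F.pt ∉ F.pos j := fun h => (mul_self_nonneg (A.form j F.pt)).not_gt h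
  rw [F.mem_Sep_iff hpt hw, F.C_subset_pos_iff i j hw, Finset.mem_Iic]
  tauto

theorem range_nabla₀ (a : Fin n → R) :
    LinearMap.range (F.nabla₀ a) = Submodule.span R {F.partialSums a} := by
  have hpt : F.pt ∈ A.compl := fun i h => F.form_pt_ne i h
  let C₀ : F.ch 0 := ⟨A.chamberAt F.pt hpt, Set.inter_empty _, F.pt, A.mem_chamberAt _ hpt, rfl⟩
  ext x
  rw [Submodule.mem_span_singleton, LinearMap.mem_range]
  constructor
  · rintro ⟨r, rfl⟩
    exact ⟨_, (F.nabla₀_eq a r).symm⟩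
  · rintro ⟨r, rfl⟩
    refine ⟨Pi.single C₀ r, ?_⟩
    rw [nabla₀_eq, Finset.sum_pi_single']
    simp

theorem phi₁_partialSums (y : Fin n → R) : F.phi₁ (F.partialSums y) = ∑ i, y i • A.e R i := by
  let E : ℕ → A.OS R := extendZero (A.e R)
  have key : ∀ N, ∑ i ∈ Finset.range N, (∑ j ∈ Finset.range (i + 1), extendZero y j) •
      (E i - E (i + 1)) = ∑ i ∈ Finset.range N, extendZero y i • E i -
        (∑ j ∈ Finset.range N, extendZero y j) • E N := by
    intro N
    induction N with
    | zero => simp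
    | succ N ih =>
      rw [Finset.sum_range_succ, ih]
      simp only [Finset.sum_range_succ _ N]
      module
  have hE : E n = 0 := by simp [E, extendZero]
  have := key n
  rw [hE, smul_zero, sub_zero, Finset.sum_range, Finset.sum_range] at this
  simp only [extendZero_val, E] at this
  rw [← this, phi₁, Fintype.linearCombination_apply, ← F.C.sum_comp]
  refine Finset.sum_congr rfl fun i _ => ?_
  rw [partialSums_C, Equiv.symm_apply_apply]
  congr 1
  rw [extendZero]
  split_ifs <;> simp

end Flag

/-- The lines through a point. -/
def through (A : LineArrangement n) (q : ℝ × ℝ) : Finset (Fin n) := {i | q ∈ A.line i}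

theorem mem_through {A : LineArrangement n} {q : ℝ × ℝ} {i : Fin n} :
    i ∈ A.through q ↔ q ∈ A.line i := by simp [through]

/-- The condition that `(∑ a i • e i) * (∑ y i • e i)` vanishes in the Orlik-Solomon algebra,
expressed at each point of the plane separately. -/
def IsLocalCocycle {R : Type*} [CommRing R] (A : LineArrangement n) (a y : Fin n → R) : Prop :=
  ∀ q, ∀ i ∈ A.through q, (∑ j ∈ A.through q, a j) * y i = a i * ∑ j ∈ A.through q, y j

namespace Flag

variable {A : LineArrangement n} {F : A.Flag} {R : Type*} [CommRing R]

theorem Coordinates.graphsThrough_eq (κ : F.Coordinates) (q : ℝ × ℝ) :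
    graphsThrough F.cross κ.slope (κ.chart q).1 (κ.chart q).2 = A.through q := by
  ext i
  rw [mem_through, κ.mem_line]
  simp [graphsThrough]

theorem Coordinates.isLocalCocycle_iff (κ : F.Coordinates) (a y : Fin n → R) :
    A.IsLocalCocycle a y ↔ ∀ x h, IsCocycleAt F.cross κ.slope a y x h := by
  constructor
  · intro H x h i hi
    have h1 := κ.graphsThrough_eq (κ.chart.symm (x, h))
    have h2 := H (κ.chart.symm (x, h)) i
    simp only [Homeomorph.apply_symm_apply] at h1
    rw [← h1] at h2
    exact h2 (by simpa [graphsThrough] using hi)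
  · intro H q i hi
    have h2 := H (κ.chart q).1 (κ.chart q).2 i
    rw [κ.graphsThrough_eq] at h2
    exact h2 ((κ.mem_line i q).1 (mem_through.1 hi))

variable (F)

/-- The cocycles of the chamber complex in degree one are given by the local conditions. -/
theorem nabla₁_partialSums_eq_zero_iff (a y : Fin n → R) :
    F.nabla₁ a (F.partialSums y) = 0 ↔ A.IsLocalCocycle a y := by
  obtain ⟨κ⟩ := F.nonempty_coordinates
  have hinv : ∀ z ∈ A.compl,
      inversions F.cross κ.slope (κ.chart z).1 (κ.chart z).2 =
        ({p | p.1 < p.2 ∧ z ∈ F.pos p.2 ∧ z ∉ F.pos p.1} : Finset (Fin n × Fin n)) := by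
    intro z hz
    refine Finset.filter_congr fun p _ => ?_
    have := (κ.mem_line p.1 z).not.1 (hz p.1)
    rw [κ.mem_pos, κ.mem_pos, not_lt, (Ne.symm this).le_iff_lt]
  rw [κ.isLocalCocycle_iff]
  constructor
  · intro H
    refine isCocycleAt_of_sum_inversions F.cross_strictMono κ.slope_antitone fun x h hx => ?_
    set z := κ.chart.symm (x, h) with hz
    have hzc : κ.chart z = (x, h) := κ.chart.apply_symm_apply _
    have hzA : z ∈ A.compl := fun i hi => hx i (by simpa [hzc] using (κ.mem_line i z).1 hi)
    have h1 := hinv z hzA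
    rw [hzc] at h1
    rw [h1]
    have hmem := A.mem_chamberAt z hzA
    by_cases hD : (A.chamberAt z hzA).1 ∩ F.space 2 = ∅
    · have h2 := F.nabla₁_partialSums a y ⟨A.chamberAt z hzA, hD, z, hmem, trivial⟩ hmem
      rw [H] at h2
      exact neg_eq_zero.1 h2.symm
    · -- there are no inversions at the points of `F¹`
      obtain ⟨_, hw, t, rfl⟩ := Set.nonempty_iff_ne_empty.2 hD
      refine Finset.sum_eq_zero fun p hp => ?_
      simp only [Finset.mem_filter, Finset.mem_univ, true_and,
        F.mem_pos_iff_of_mem_chamber hmem hw] at hp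
      have := F.cross_strictMono hp.1
      have h3 := (F.mem_pos_iff _ _).1 hp.2.1
      exact absurd ((F.mem_pos_iff _ _).2 (this.trans h3)) hp.2.2
  · intro H
    ext D
    obtain ⟨z, hz⟩ := D.1.nonempty
    have hzA := D.1.subset_compl hz
    rw [F.nabla₁_partialSums a y D hz, ← hinv z hzA,
      sum_inversions_eq_zero F.cross_strictMono κ.slope_antitone H
        fun i => (κ.mem_line i z).not.1 (hzA i)]
    simp

end Flag

/-! ### Concurrent lines -/

section Concurrent

variable {A : LineArrangement n}

theorem form_eq_of_mem {i : Fin n} {p : ℝ × ℝ} (hp : p ∈ A.line i) (z : ℝ × ℝ) :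
    A.form i z = (A.form i).linear (z - p) := by
  have h := A.form_add i p (z - p)
  have hp' : A.form i p = 0 := hp
  rwa [add_sub_cancel, hp', zero_add] at h

theorem linear_apply (A : LineArrangement n) (i : Fin n) (v : ℝ × ℝ) : (A.form i).linear v =
    (A.form i).linear (1, 0) * v.1 + (A.form i).linear (0, 1) * v.2 := by
  have h : v = v.1 • ((1, 0) : ℝ × ℝ) + v.2 • ((0, 1) : ℝ × ℝ) := by ext <;> simp
  conv_lhs => rw [h, map_add, map_smul, map_smul, smul_eq_mul, smul_eq_mul]
  ring

theorem linear_coeff_ne_zero (A : LineArrangement n) (i : Fin n) :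
    (A.form i).linear (1, 0) ≠ 0 ∨ (A.form i).linear (0, 1) ≠ 0 := by
  by_contra! h
  refine A.linear_ne_zero i (LinearMap.ext fun v => ?_)
  rw [linear_apply, h.1, h.2]
  simp

/-- Distinct lines have at most one common point. -/
theorem eq_of_mem_line {i j : Fin n} (hij : i ≠ j) {p q : ℝ × ℝ} (hpi : p ∈ A.line i)
    (hpj : p ∈ A.line j) (hqi : q ∈ A.line i) (hqj : q ∈ A.line j) : p = q := by
  by_contra hpq
  -- both linear parts vanish at `q - p`, so they are proportional
  have key : ∀ i j : Fin n, p ∈ A.line i → p ∈ A.line j → q ∈ A.line i → q ∈ A.line j →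
      A.line i ⊆ A.line j := by
    intro i j hpi hpj hqi hqj z hz
    have h1 : A.form i q = 0 := hqi
    have h2 : A.form j q = 0 := hqj
    have h3 : A.form i z = 0 := hz
    show A.form j z = 0
    rw [form_eq_of_mem hpi, linear_apply] at h1 h3
    rw [form_eq_of_mem hpj, linear_apply] at h2 ⊢
    have h4 : (A.form i).linear (1, 0) * (A.form j).linear (0, 1) =
        (A.form i).linear (0, 1) * (A.form j).linear (1, 0) := by
      have hd : (q - p).1 ≠ 0 ∨ (q - p).2 ≠ 0 := by
        by_contra! h
        exact hpq (sub_eq_zero.1 (Prod.ext h.1 h.2)).symm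
      rcases hd with hd | hd <;> refine mul_right_cancel₀ hd ?_
      · linear_combination (A.form j).linear (0, 1) * h1 - (A.form i).linear (0, 1) * h2
      · linear_combination (A.form i).linear (1, 0) * h2 - (A.form j).linear (1, 0) * h1
    rcases A.linear_coeff_ne_zero i with h5 | h5 <;> refine mul_left_cancel₀ h5 ?_
    · linear_combination (A.form j).linear (1, 0) * h3 + (z - p).2 * h4
    · linear_combination (A.form j).linear (0, 1) * h3 - (z - p).1 * h4
  exact hij (A.line_injective
    ((key i j hpi hpj hqi hqj).antisymm (key j i hpj hpi hqj hqi)))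

theorem exists_mem_line_ne {i : Fin n} {p : ℝ × ℝ} (hp : p ∈ A.line i) :
    ∃ z ∈ A.line i, z ≠ p := by
  refine ⟨p + (-(A.form i).linear (0, 1), (A.form i).linear (1, 0)), ?_, ?_⟩
  · show A.form i _ = 0
    rw [form_eq_of_mem hp, add_sub_cancel_left, linear_apply]
    ring
  · rw [Ne, add_eq_left]
    intro h
    rcases A.linear_coeff_ne_zero i with h' | h'
    · exact h' (congrArg Prod.snd h)
    · exact h' (neg_eq_zero.1 (congrArg Prod.fst h))

theorem line_nonempty (A : LineArrangement n) (i : Fin n) : (A.line i).Nonempty := by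
  obtain ⟨v, hv⟩ : ∃ v, (A.form i).linear v ≠ 0 := by
    by_contra! h
    exact A.linear_ne_zero i (LinearMap.ext h)
  refine ⟨0 + (-(A.form i 0) / (A.form i).linear v) • v, ?_⟩
  show A.form i _ = 0
  rw [form_add, map_smul, smul_eq_mul, div_mul_cancel₀ _ hv, add_neg_cancel]

theorem sum_smul_form_apply (A : LineArrangement n) (S : Finset (Fin n)) (g : Fin n → ℝ)
    (z : ℝ × ℝ) : (∑ i ∈ S, g i • A.form i) z = ∑ i ∈ S, g i * A.form i z := by
  induction S using Finset.induction_on with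
  | empty => simp
  | insert i S hi ih => simp [Finset.sum_insert hi, ih]

theorem dependent_iff (S : Finset (Fin n)) : A.Dependent S ↔ (⋂ i ∈ S, A.line i).Nonempty ∧
    ∃ g : Fin n → ℝ, (∀ z, ∑ i ∈ S, g i * A.form i z = 0) ∧ ∃ i ∈ S, g i ≠ 0 := by
  have h1 := not_linearIndepOn_finset_iff (R := ℝ) (s := S) (v := A.form)
  refine and_congr_right fun _ => Iff.trans h1 (exists_congr fun g => and_congr_left fun _ => ?_)
  simp_rw [← sum_smul_form_apply]
  exact ⟨fun h z => by rw [h]; rfl, fun h => AffineMap.ext h⟩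

theorem not_dependent_singleton (i : Fin n) : ¬ A.Dependent {i} := by
  rw [dependent_iff]
  rintro ⟨⟨p, hp⟩, g, hg, j, hj, hgj⟩
  rw [Finset.mem_singleton] at hj
  subst hj
  obtain ⟨v, hv⟩ : ∃ v, (A.form j).linear v ≠ 0 := by
    by_contra! h
    exact A.linear_ne_zero j (LinearMap.ext h)
  have h := hg (p + v)
  rw [Finset.sum_singleton, form_eq_of_mem (by simpa using hp), add_sub_cancel_left] at h
  exact mul_ne_zero hgj hv h

theorem not_dependent_pair (i j : Fin n) : ¬ A.Dependent {i, j} := by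
  by_cases hij : i = j
  · rw [hij, Finset.pair_eq_singleton]
    exact not_dependent_singleton j
  rw [dependent_iff]
  rintro ⟨⟨p, hp⟩, g, hg, k, hk, hgk⟩
  simp only [Finset.mem_insert, Finset.mem_singleton, Set.mem_iInter, forall_eq_or_imp,
    forall_eq] at hp hk
  simp only [Finset.sum_pair hij] at hg
  -- a second point of one line isolates the coefficient of the other one
  obtain ⟨z, hz, hzp⟩ := exists_mem_line_ne hp.1
  obtain ⟨w, hw, hwp⟩ := exists_mem_line_ne hp.2
  have hz0 : A.form i z = 0 := hz
  have hw0 : A.form j w = 0 := hw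
  have hz1 : A.form j z ≠ 0 := fun h => hzp (eq_of_mem_line hij hz h hp.1 hp.2)
  have hw1 : A.form i w ≠ 0 := fun h => hwp (eq_of_mem_line hij h hw hp.1 hp.2)
  have h1 := hg z
  have h2 := hg w
  rw [hz0, mul_zero, zero_add] at h1
  rw [hw0, mul_zero, add_zero] at h2
  rcases hk with rfl | rfl
  · exact mul_ne_zero hgk hw1 h2
  · exact mul_ne_zero hgk hz1 h1

/-- Linear forms on the plane that vanish at a common point span a space of dimension at most
two. -/
theorem dependent_of_two_lt_card {S : Finset (Fin n)} (hS : 2 < S.card) {p : ℝ × ℝ}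
    (hp : ∀ i ∈ S, p ∈ A.line i) : A.Dependent S := by
  rw [dependent_iff]
  refine ⟨⟨p, by simpa using hp⟩, ?_⟩
  have h : ¬ LinearIndepOn ℝ (fun i => (A.form i).linear) (S : Set (Fin n)) := by
    intro h
    have h1 := LinearIndependent.fintype_card_le_finrank h
    rw [Module.finrank_linearMap] at h1
    simp at h1
    omega
  obtain ⟨g, hg, hgi⟩ := not_linearIndepOn_finset_iff.1 h
  refine ⟨g, fun z => ?_, hgi⟩
  have h1 := congrArg (fun L : ℝ × ℝ →ₗ[ℝ] ℝ => L (z - p)) hg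
  simp only [LinearMap.sum_apply, LinearMap.smul_apply, smul_eq_mul, LinearMap.zero_apply] at h1
  rw [← h1]
  exact Finset.sum_congr rfl fun i hi => by rw [form_eq_of_mem (hp i hi)]

end Concurrent

/-! ### Products of degree two in the Orlik-Solomon algebra -/

section Products

variable {A : LineArrangement n} {R : Type*} [CommRing R]

theorem boundary_ι_mul (i : Fin n) (x : ExteriorAlgebra R (Fin n → R)) :
    boundary R (ExteriorAlgebra.ι R (Pi.single i (1 : R)) * x) =
      x - ExteriorAlgebra.ι R (Pi.single i (1 : R)) * boundary R x := by
  have h : (∑ j : Fin n, LinearMap.proj j : (Fin n → R) →ₗ[R] R) (Pi.single i 1) = 1 := by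
    simp [LinearMap.sum_apply]
  have h1 := CliffordAlgebra.contractLeft_ι_mul (Q := (0 : QuadraticForm R (Fin n → R)))
    (∑ j : Fin n, LinearMap.proj j) (Pi.single i (1 : R)) x
  rw [h, one_smul] at h1
  exact h1

theorem boundary_one : boundary R (1 : ExteriorAlgebra R (Fin n → R)) = 0 :=
  CliffordAlgebra.contractLeft_one _ _

theorem boundary_ι (i : Fin n) :
    boundary R (ExteriorAlgebra.ι R (Pi.single i (1 : R))) = 1 := by
  simpa [boundary_one] using boundary_ι_mul (R := R) i 1

theorem e_mul_self (i : Fin n) : A.e R i * A.e R i = 0 := by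
  rw [e, ← map_mul, ExteriorAlgebra.ι_sq_zero, map_zero]

theorem e_mul_swap (i j : Fin n) : A.e R j * A.e R i = -(A.e R i * A.e R j) := by
  have h := congrArg (RingQuot.mkAlgHom R (OSRel R A))
    (ExteriorAlgebra.ι_add_mul_swap (R := R) (Pi.single j (1 : R)) (Pi.single i (1 : R)))
  rw [map_add, map_mul, map_mul, map_zero] at h
  exact eq_neg_of_add_eq_zero_left h

theorem e_mul_of_parallel {i j : Fin n} (h : A.line i ∩ A.line j = ∅) : A.e R i * A.e R j = 0 := by
  wlog hij : i < j generalizing i j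
  · rcases (not_lt.1 hij).eq_or_lt with rfl | hlt
    · exact e_mul_self _
    · rw [e_mul_swap, this (by rwa [Set.inter_comm]) hlt, neg_zero]
  have h1 := RingQuot.mkAlgHom_rel R (OSRel.empty (R := R) (A := A) {i, j} (by simpa using h))
  have hsort : ({i, j} : Finset (Fin n)).sort (· ≤ ·) = [i, j] := by
    rw [Finset.sort_insert _ (by simpa using hij.le) (by simpa using hij.ne),
      Finset.sort_singleton]
  simpa [monomial, hsort, e] using h1

/-- The relation of three concurrent lines in factored form. -/
theorem sub_mul_sub_of_concurrent {i j k : Fin n} {p : ℝ × ℝ} (hi : p ∈ A.line i)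
    (hj : p ∈ A.line j) (hk : p ∈ A.line k) (hij : i ≤ j) (hik : i ≤ k) :
    (A.e R j - A.e R i) * (A.e R k - A.e R i) = 0 := by
  rcases hij.eq_or_lt with rfl | hij
  · simp
  rcases hik.eq_or_lt with rfl | hik
  · simp
  wlog hjk : j < k generalizing j k
  · rcases (not_lt.1 hjk).eq_or_lt with rfl | hlt
    · simp [sub_mul, mul_sub, e_mul_self, e_mul_swap i k]
    · have h := this hk hj hik.le hij.le hik hij hlt
      simp only [sub_mul, mul_sub, e_mul_self] at h ⊢
      rw [e_mul_swap k j, e_mul_swap i j]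
      rw [e_mul_swap i k] at h
      linear_combination (norm := abel) -h
  have hcard : 2 < ({i, j, k} : Finset (Fin n)).card := by
    rw [Finset.card_eq_three.2 ⟨i, j, k, hij.ne, hik.ne, hjk.ne, rfl⟩]
    norm_num
  have h1 := RingQuot.mkAlgHom_rel R (OSRel.dependent (R := R) (A := A) {i, j, k}
    (dependent_of_two_lt_card (p := p) hcard (by simp [hi, hj, hk])))
  have hsort : ({i, j, k} : Finset (Fin n)).sort (· ≤ ·) = [i, j, k] := by
    rw [Finset.sort_insert _ (by simp [hij.le, hik.le]) (by simp [hij.ne, hik.ne]),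
      Finset.sort_insert _ (by simpa using hjk.le) (by simpa using hjk.ne),
      Finset.sort_singleton]
  rw [monomial, hsort] at h1
  simp only [List.map_cons, List.map_nil, List.prod_cons, List.prod_nil, boundary_ι_mul,
    boundary_ι, mul_one, map_sub, map_mul, map_zero] at h1
  simp only [← e.eq_1, mul_sub] at h1
  simp only [sub_mul, mul_sub, e_mul_self]
  rw [e_mul_swap i j]
  linear_combination (norm := abel) h1

/-- The products of local components vanish under the local cocycle condition. -/
theorem sum_through_mul_sum_through {a y : Fin n → R} (H : A.IsLocalCocycle a y) (p : ℝ × ℝ) :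
    (∑ j ∈ A.through p, a j • A.e R j) * ∑ k ∈ A.through p, y k • A.e R k = 0 := by
  rcases (A.through p).eq_empty_or_nonempty with h0 | hne
  · simp [h0]
  set L := A.through p with hL
  obtain ⟨i, hiL, hmin⟩ : ∃ i ∈ L, ∀ j ∈ L, i ≤ j := L.exists_minimal hne |>.imp fun i hi =>
    ⟨hi.1, fun j hj => le_of_not_gt fun h => (hi.2 hj h.le).not_gt h⟩
  have hrel : ∀ j ∈ L, ∀ k ∈ L, A.e R j * A.e R k = A.e R i * (A.e R k - A.e R j) := by
    intro j hj k hk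
    have h := sub_mul_sub_of_concurrent (R := R) (mem_through.1 hiL) (mem_through.1 hj)
      (mem_through.1 hk) (hmin j hj) (hmin k hk)
    simp only [sub_mul, mul_sub, e_mul_self, e_mul_swap i j] at h ⊢
    rw [← sub_eq_zero, ← h]
    abel
  calc (∑ j ∈ L, a j • A.e R j) * ∑ k ∈ L, y k • A.e R k
      = ∑ j ∈ L, ∑ k ∈ L, (a j * y k) • (A.e R i * A.e R k - A.e R i * A.e R j) := by
        rw [Finset.sum_mul_sum]
        refine Finset.sum_congr rfl fun j hj => Finset.sum_congr rfl fun k hk => ?_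
        rw [smul_mul_smul_comm, hrel j hj k hk, mul_sub]
    _ = ∑ k ∈ L, ((∑ j ∈ L, a j) * y k - a k * ∑ j ∈ L, y j) • (A.e R i * A.e R k) := by
        simp only [smul_sub, Finset.sum_sub_distrib]
        rw [Finset.sum_comm, ← Finset.sum_sub_distrib]
        refine Finset.sum_congr rfl fun k _ => ?_
        rw [← Finset.sum_smul, ← Finset.sum_smul, ← sub_smul, Finset.sum_mul, Finset.mul_sum]
    _ = 0 := Finset.sum_eq_zero fun k hk => by rw [H p k hk, sub_self, zero_smul]

/-- The common point of two lines, with the value `0` for parallel lines. -/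
def meet (A : LineArrangement n) (p : Fin n × Fin n) : ℝ × ℝ :=
  if h : (A.line p.1 ∩ A.line p.2).Nonempty then h.some else 0

theorem meet_eq_iff {p : Fin n × Fin n} (hne : p.1 ≠ p.2)
    (h : (A.line p.1 ∩ A.line p.2).Nonempty) (q : ℝ × ℝ) :
    A.meet p = q ↔ q ∈ A.line p.1 ∧ q ∈ A.line p.2 := by
  have hm : A.meet p ∈ A.line p.1 ∩ A.line p.2 := by
    rw [meet, dif_pos h]
    exact h.some_mem
  exact ⟨fun h => h ▸ hm, fun h => eq_of_mem_line hne hm.1 hm.2 h.1 h.2⟩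

/-- The products of parallel lines vanish, and the others are grouped by intersection points. -/
theorem eta_mul_eq_zero {a y : Fin n → R} (H : A.IsLocalCocycle a y) :
    A.eta a * ∑ k, y k • A.e R k = 0 := by
  let s : Finset (Fin n × Fin n) := {p | p.1 ≠ p.2 ∧ (A.line p.1 ∩ A.line p.2).Nonempty}
  let f : Fin n × Fin n → A.OS R := fun p => (a p.1 • A.e R p.1) * (y p.2 • A.e R p.2)
  have hdiag : ∀ p : Fin n × Fin n, p.1 = p.2 → f p = 0 := by
    intro p hp
    simp only [f, hp, smul_mul_smul_comm, e_mul_self, smul_zero]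
  have h1 : A.eta a * ∑ k, y k • A.e R k = ∑ p ∈ s, f p := by
    rw [eta, Finset.sum_mul_sum, ← Finset.sum_product']
    symm
    refine Finset.sum_subset (Finset.subset_univ _) fun p _ hp => ?_
    by_cases hne : p.1 = p.2
    · exact hdiag p hne
    · have : A.line p.1 ∩ A.line p.2 = ∅ := by
        rw [← Set.not_nonempty_iff_eq_empty]
        exact fun h => hp (by simp [s, hne, h])
      simp only [f, smul_mul_smul_comm, e_mul_of_parallel this, smul_zero]
  rw [h1]
  refine sum_eq_zero_of_fiberwise s A.meet f fun p hp => ?_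
  rw [← sum_through_mul_sum_through H (A.meet p), Finset.sum_mul_sum, ← Finset.sum_product']
  refine Finset.sum_subset (fun q hq => ?_) fun q hq hq' => ?_
  · simp only [Finset.mem_filter, s, Finset.mem_univ, true_and] at hq
    rw [Finset.mem_product, mem_through, mem_through]
    exact (meet_eq_iff hq.1.1 hq.1.2 _).1 hq.2
  · rw [Finset.mem_product, mem_through, mem_through] at hq
    by_contra hf
    have hne : q.1 ≠ q.2 := fun h => hf (hdiag q h)
    have hn : (A.line q.1 ∩ A.line q.2).Nonempty := ⟨_, hq⟩
    exact hq' (Finset.mem_filter.2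
      ⟨Finset.mem_filter.2 ⟨Finset.mem_univ _, hne, hn⟩, (meet_eq_iff hne hn _).2 hq⟩)

end Products

/-! ### A representation that detects products of degree two -/

section Representation

variable {A : LineArrangement n} {R : Type*} [CommRing R]

/-- For a bilinear form `β`, left multiplication by elements of degree one on the graded module
`R ⊕ Rⁿ ⊕ R` with products `v * u = β v u` in degree two. -/
def gradedMul (β : (Fin n → R) →ₗ[R] (Fin n → R) →ₗ[R] R) :
    (Fin n → R) →ₗ[R] Module.End R (R × (Fin n → R) × R) :=
  LinearMap.mk₂ R (fun v x => (0, x.1 • v, β v x.2.1))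
    (fun v w x => by simp) (fun r v x => by simp [smul_smul, mul_comm])
    (fun v x z => by simp [add_smul]) (fun r v x => by simp [mul_smul])

@[simp]
theorem gradedMul_apply (β : (Fin n → R) →ₗ[R] (Fin n → R) →ₗ[R] R) (v : Fin n → R)
    (x : R × (Fin n → R) × R) : gradedMul β v x = (0, x.1 • v, β v x.2.1) := rfl

theorem gradedMul_mul_mul (β : (Fin n → R) →ₗ[R] (Fin n → R) →ₗ[R] R) (u v w : Fin n → R)
    (T : Module.End R (R × (Fin n → R) × R)) :
    gradedMul β u * (gradedMul β v * (gradedMul β w * T)) = 0 := by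
  ext <;> simp

theorem gradedMul_mul_eq_zero {β : (Fin n → R) →ₗ[R] (Fin n → R) →ₗ[R] R} {u v : Fin n → R}
    (h : β u v = 0) : gradedMul β u * gradedMul β v = 0 := by
  ext <;> simp [h]

/-- An alternating form that satisfies the relations of degree two gives a representation of the
Orlik-Solomon algebra. -/
theorem exists_representation (β : (Fin n → R) →ₗ[R] (Fin n → R) →ₗ[R] R) (hβ : ∀ v, β v v = 0)
    (hpar : ∀ i j, A.line i ∩ A.line j = ∅ → β (Pi.single i 1) (Pi.single j 1) = 0)
    (hdep : ∀ i j k p, i ≠ j → i ≠ k → j ≠ k → p ∈ A.line i → p ∈ A.line j → p ∈ A.line k →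
      β (Pi.single j 1 - Pi.single i 1) (Pi.single k 1 - Pi.single i 1) = 0) :
    ∃ ρ : A.OS R →ₐ[R] Module.End R (R × (Fin n → R) × R),
      ∀ i, ρ (A.e R i) = gradedMul β (Pi.single i 1) := by
  let g : ExteriorAlgebra R (Fin n → R) →ₐ[R] Module.End R (R × (Fin n → R) × R) :=
    ExteriorAlgebra.lift R ⟨gradedMul β, fun v => gradedMul_mul_eq_zero (hβ v)⟩
  have hg : ∀ v, g (ExteriorAlgebra.ι R v) = gradedMul β v := fun v => by simp [g]
  have hrel : ∀ ⦃x y⦄, OSRel R A x y → g x = g y := by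
    rintro _ _ (⟨S, hS⟩ | ⟨S, hS⟩)
    · have hS' := S.sort_toFinset (· ≤ ·)
      rw [monomial]
      generalize S.sort (· ≤ ·) = l at hS' ⊢
      subst hS'
      match l with
      | [] => simp at hS
      | [i] => exact absurd (by simpa using hS) (A.line_nonempty i).ne_empty
      | [i, j] =>
        have h := gradedMul_mul_eq_zero (hpar i j (by simpa using hS))
        simpa [hg] using h
      | i :: j :: k :: l => simp [hg, gradedMul_mul_mul]
    · have hS' := S.sort_toFinset (· ≤ ·)
      have hnd := S.sort_nodup (· ≤ ·)
      rw [monomial]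
      generalize S.sort (· ≤ ·) = l at hS' hnd ⊢
      subst hS'
      match l with
      | [] => exact absurd (linearIndependent_empty_type (ι := (∅ : Finset (Fin n)))) hS.2
      | [i] => exact absurd (by simpa using hS) (not_dependent_singleton i)
      | [i, j] => exact absurd (by simpa using hS) (not_dependent_pair i j)
      | [i, j, k] =>
        obtain ⟨p, hp⟩ := hS.1
        simp at hp hnd
        have h := gradedMul_mul_eq_zero (hdep i j k p hnd.1.1 hnd.1.2 hnd.2 hp.1 hp.2.1 hp.2.2)
        have hi := gradedMul_mul_eq_zero (hβ (Pi.single i 1))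
        have hij := gradedMul_mul_eq_zero (hβ (Pi.single i 1 + Pi.single j 1))
        have hj := gradedMul_mul_eq_zero (hβ (Pi.single j 1))
        simp only [map_add, map_sub, add_mul, mul_add, sub_mul, mul_sub, hi, hj] at h hij
        simp only [List.map_cons, List.map_nil, List.prod_cons, List.prod_nil, boundary_ι_mul,
          boundary_ι, mul_one, map_sub, map_mul, map_zero, hg, mul_sub]
        linear_combination (norm := abel) h + hij
      | i :: j :: k :: m :: l =>
        simp only [List.map_cons, List.prod_cons, boundary_ι_mul, map_sub, map_mul, hg, mul_sub,
          gradedMul_mul_mul, map_zero, mul_zero, sub_zero]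
  refine ⟨RingQuot.liftAlgHom R ⟨g, hrel⟩, fun i => ?_⟩
  rw [e, RingQuot.liftAlgHom_mkAlgHom_apply, hg]

/-- In a representation as above, linear combinations of the generators act as expected. -/
theorem representation_sum {β : (Fin n → R) →ₗ[R] (Fin n → R) →ₗ[R] R}
    {ρ : A.OS R →ₐ[R] Module.End R (R × (Fin n → R) × R)}
    (hρ : ∀ i, ρ (A.e R i) = gradedMul β (Pi.single i 1)) (y : Fin n → R) :
    ρ (∑ i, y i • A.e R i) = gradedMul β y := by
  conv_rhs => rw [← Finset.univ_sum_single y]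
  rw [map_sum, map_sum]
  refine Finset.sum_congr rfl fun i _ => ?_
  rw [map_smul, hρ, ← map_smul, ← Pi.single_smul, smul_eq_mul, mul_one]

theorem sum_smul_e_injective (A : LineArrangement n) (R : Type*) [CommRing R] :
    Function.Injective fun y : Fin n → R => ∑ i, y i • A.e R i := by
  obtain ⟨ρ, hρ⟩ := exists_representation (A := A) (R := R) 0 (by simp) (by simp) (by simp)
  intro y z hyz
  have h := congrArg (fun x => (ρ x (1, 0, 0)).2.1) hyz
  simpa [representation_sum hρ] using h

/-- The form `v_q u_i - v_i u_q`, where the subscript `q` stands for the sum over the lines through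
`q`. -/
def localForm (A : LineArrangement n) (R : Type*) [CommRing R] (q : ℝ × ℝ) (i : Fin n) :
    (Fin n → R) →ₗ[R] (Fin n → R) →ₗ[R] R :=
  LinearMap.mk₂ R
    (fun v u => (∑ j ∈ A.through q, v j) * u i - v i * ∑ j ∈ A.through q, u j)
    (fun v w u => by simp only [Pi.add_apply, Finset.sum_add_distrib]; ring)
    (fun r v u => by simp only [Pi.smul_apply, smul_eq_mul, ← Finset.mul_sum]; ring)
    (fun v u w => by simp only [Pi.add_apply, Finset.sum_add_distrib]; ring)
    (fun r v u => by simp only [Pi.smul_apply, smul_eq_mul, ← Finset.mul_sum]; ring)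

theorem localForm_apply (q : ℝ × ℝ) (i : Fin n) (v u : Fin n → R) : A.localForm R q i v u =
    (∑ j ∈ A.through q, v j) * u i - v i * ∑ j ∈ A.through q, u j := rfl

theorem localForm_single {q : ℝ × ℝ} {i : Fin n} (hi : i ∈ A.through q) {j k : Fin n}
    (h : ¬ (j ∈ A.through q ∧ k ∈ A.through q)) :
    A.localForm R q i (Pi.single j 1) (Pi.single k 1) = 0 := by
  have hs : ∀ j ∉ A.through q, ∑ l ∈ A.through q, (Pi.single j 1 : Fin n → R) l = 0 :=
    fun j hj => Finset.sum_eq_zero fun l hl => Pi.single_eq_of_ne (by rintro rfl; exact hj hl) _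
  have hs' : ∀ j ∉ A.through q, (Pi.single j 1 : Fin n → R) i = 0 :=
    fun j hj => Pi.single_eq_of_ne (by rintro rfl; exact hj hi) _
  rw [localForm_apply]
  by_cases hj : j ∈ A.through q
  · have hk : k ∉ A.through q := fun hk => h ⟨hj, hk⟩
    rw [hs k hk, hs' k hk, mul_zero, mul_zero, sub_zero]
  · rw [hs j hj, hs' j hj, zero_mul, zero_mul, sub_zero]

/-- The cocycles of the Aomoto complex in degree one are given by the local conditions, which are
detected by the representations attached to `localForm`. -/
theorem eta_mul_eq_zero_iff (a y : Fin n → R) :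
    A.eta a * ∑ k, y k • A.e R k = 0 ↔ A.IsLocalCocycle a y := by
  refine ⟨fun h q i hi => ?_, eta_mul_eq_zero⟩
  have halt : ∀ v, A.localForm R q i v v = 0 := fun v => by
    rw [localForm_apply]
    ring
  have hpar : ∀ j k, A.line j ∩ A.line k = ∅ →
      A.localForm R q i (Pi.single j 1) (Pi.single k 1) = 0 := by
    intro j k hjk
    refine localForm_single hi fun hm => ?_
    rw [mem_through, mem_through] at hm
    exact Set.eq_empty_iff_forall_notMem.1 hjk q hm
  have hdep : ∀ j k l p, j ≠ k → j ≠ l → k ≠ l → p ∈ A.line j → p ∈ A.line k → p ∈ A.line l →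
      A.localForm R q i (Pi.single k 1 - Pi.single j 1) (Pi.single l 1 - Pi.single j 1) = 0 := by
    intro j k l p hjk hjl hkl hj hk hl
    by_cases hpq : p = q
    · subst hpq
      have hs : ∀ j, p ∈ A.line j → ∑ l ∈ A.through p, (Pi.single j 1 : Fin n → R) l = 1 := by
        intro j hj
        rw [Finset.sum_pi_single', if_pos (mem_through.2 hj)]
      simp [localForm_apply, hs, hj, hk, hl]
    · -- at most one of the three lines passes through `q`
      have hz : ∀ j k, j ≠ k → p ∈ A.line j → p ∈ A.line k →
          A.localForm R q i (Pi.single j 1) (Pi.single k 1) = 0 := by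
        intro j k hjk hj hk
        refine localForm_single hi fun hm => hpq ?_
        rw [mem_through, mem_through] at hm
        exact eq_of_mem_line hjk hj hk hm.1 hm.2
      have hz' : A.localForm R q i (Pi.single j 1) (Pi.single j 1) = 0 := by
        rw [localForm_apply]
        ring
      simp [map_sub, hz k l hkl hk hl, hz k j hjk.symm hk hj, hz j l hjl hj hl, hz']
  obtain ⟨ρ, hρ⟩ := exists_representation (A.localForm R q i) halt hpar hdep
  have h1 := congrArg (fun x => (ρ x (1, 0, 0)).2.2) h
  simp only [eta, map_mul, representation_sum hρ] at h1
  simpa [localForm_apply, sub_eq_zero] using h1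

end Representation

/-! ### The isomorphism of first cohomology modules -/

section Cohomology

variable {A : LineArrangement n} {R : Type*} [CommRing R]

theorem mem_submoduleOf_iff {M : Type*} [AddCommGroup M] [Module R M] {N P : Submodule R M}
    {x : P} : x ∈ N.submoduleOf P ↔ (x : M) ∈ N := Iff.rfl

theorem mkAlgHom_ι (A : LineArrangement n) (y : Fin n → R) :
    RingQuot.mkAlgHom R (OSRel R A) (ExteriorAlgebra.ι R y) = ∑ i, y i • A.e R i := by
  conv_lhs => rw [← Finset.univ_sum_single y]
  rw [map_sum, map_sum]
  refine Finset.sum_congr rfl fun i _ => ?_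
  rw [e, ← map_smul, ← map_smul, ← Pi.single_smul, smul_eq_mul, mul_one]

theorem mem_osPart_one {x : A.OS R} :
    x ∈ A.osPart R 1 ↔ ∃ y : Fin n → R, ∑ i, y i • A.e R i = x := by
  rw [osPart, ExteriorAlgebra.exteriorPower, pow_one]
  simp only [Submodule.mem_map, LinearMap.mem_range, exists_exists_eq_and, AlgHom.toLinearMap_apply,
    mkAlgHom_ι]

theorem aomotoB1_eq (a : Fin n → R) : A.aomotoB1 a = Submodule.span R {A.eta a} := by
  rw [aomotoB1, osPart, ExteriorAlgebra.exteriorPower, pow_zero, Submodule.one_eq_span, Submodule.map_span,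
    Set.image_singleton, Submodule.map_span, Set.image_singleton]
  simp

variable (F : A.Flag)

theorem Flag.nabla₁_nabla₀ (a : Fin n → R) : F.nabla₁ a ∘ₗ F.nabla₀ a = 0 := by
  refine LinearMap.ext fun x => ?_
  rw [LinearMap.comp_apply, F.nabla₀_eq, map_smul,
    (F.nabla₁_partialSums_eq_zero_iff a a).2 fun q i _ => mul_comm _ _, smul_zero,
    LinearMap.zero_apply]

theorem Flag.phi₁_injective : Function.Injective (F.phi₁ (R := R)) := by
  intro x x' h
  obtain ⟨y, rfl⟩ := F.partialSums_surjective x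
  obtain ⟨y', rfl⟩ := F.partialSums_surjective x'
  rw [F.phi₁_partialSums, F.phi₁_partialSums] at h
  rw [A.sum_smul_e_injective R h]

theorem Flag.phi₁_mem_aomotoZ1 (a : Fin n → R) {z : F.ch 1 → R}
    (hz : z ∈ LinearMap.ker (F.nabla₁ a)) : F.phi₁ z ∈ A.aomotoZ1 a := by
  obtain ⟨y, rfl⟩ := F.partialSums_surjective z
  rw [LinearMap.mem_ker, F.nabla₁_partialSums_eq_zero_iff] at hz
  rw [F.phi₁_partialSums]
  exact ⟨mem_osPart_one.2 ⟨y, rfl⟩, eta_mul_eq_zero hz⟩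

theorem Flag.exists_of_mem_aomotoZ1 (a : Fin n → R) {w : A.OS R} (hw : w ∈ A.aomotoZ1 a) :
    ∃ z ∈ LinearMap.ker (F.nabla₁ a), F.phi₁ z = w := by
  obtain ⟨h1, h2⟩ := hw
  obtain ⟨y, rfl⟩ := mem_osPart_one.1 h1
  exact ⟨F.partialSums y, (F.nabla₁_partialSums_eq_zero_iff a y).2 ((eta_mul_eq_zero_iff a y).1 h2),
    F.phi₁_partialSums y⟩

theorem Flag.exists_cohomology_equiv (a : Fin n → R) :
    ∃ φ : F.H1 a ≃ₗ[R] A.AomotoH1 a, ∀ z : LinearMap.ker (F.nabla₁ a),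
      ∃ hz : F.phi₁ z.1 ∈ A.aomotoZ1 a,
        φ (Submodule.Quotient.mk z) = Submodule.Quotient.mk ⟨F.phi₁ z.1, hz⟩ := by
  let f : LinearMap.ker (F.nabla₁ a) →ₗ[R] A.aomotoZ1 a :=
    F.phi₁.restrict fun _ => F.phi₁_mem_aomotoZ1 a
  have hf : Function.Bijective f := by
    refine ⟨fun z z' h => Subtype.ext (F.phi₁_injective (congrArg Subtype.val h)), fun w => ?_⟩
    obtain ⟨z, hz, h⟩ := F.exists_of_mem_aomotoZ1 a w.2
    exact ⟨⟨z, hz⟩, Subtype.ext h⟩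
  let E := LinearEquiv.ofBijective f hf
  have hη : F.phi₁ (F.partialSums a) = A.eta a := F.phi₁_partialSums a
  have hE : ((LinearMap.range (F.nabla₀ a)).submoduleOf (LinearMap.ker (F.nabla₁ a))).map
      (E : LinearMap.ker (F.nabla₁ a) →ₗ[R] A.aomotoZ1 a) =
        (A.aomotoB1 a).submoduleOf (A.aomotoZ1 a) := by
    rw [F.range_nabla₀, aomotoB1_eq]
    ext w
    obtain ⟨z, rfl⟩ := E.surjective w
    rw [Submodule.mem_map_equiv, E.symm_apply_apply, mem_submoduleOf_iff,
      mem_submoduleOf_iff, Submodule.mem_span_singleton, Submodule.mem_span_singleton]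
    refine exists_congr fun r => ?_
    rw [← hη, ← map_smul F.phi₁]
    exact (F.phi₁_injective.eq_iff (b := z.1)).symm
  exact ⟨Submodule.Quotient.equiv _ _ E hE, fun z => ⟨F.phi₁_mem_aomotoZ1 a z.2, rfl⟩⟩

end Cohomology

/-! ### Classes of parallel lines -/

namespace Flag.Coordinates

variable {A : LineArrangement n} {F : A.Flag} (κ : F.Coordinates) {R : Type*} [CommRing R]

theorem parallel_iff {i j : Fin n} (hij : i ≠ j) :
    A.line i ∩ A.line j = ∅ ↔ κ.slope i = κ.slope j := by
  constructor
  · intro h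
    by_contra hne
    have h1 := (crossPoint_eq_iff (c := F.cross) (p := (i, j)) hne _ _).1 rfl
    refine Set.eq_empty_iff_forall_notMem.1 h
      (κ.chart.symm (crossPoint F.cross κ.slope (i, j))) ⟨?_, ?_⟩
    · rw [κ.mem_line, Homeomorph.apply_symm_apply]
      exact h1.1
    · rw [κ.mem_line, Homeomorph.apply_symm_apply]
      exact h1.2
  · rintro h
    rw [Set.eq_empty_iff_forall_notMem]
    rintro z ⟨h1, h2⟩
    rw [κ.mem_line] at h1 h2
    rw [← h] at h2
    exact hij (F.cross_strictMono.injective (by linarith))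

theorem lt_of_slope_lt {i j : Fin n} (h : κ.slope j < κ.slope i) : i < j :=
  lt_of_not_ge fun hle => (κ.slope_antitone hle).not_gt h

/-- The local conditions at the points of `H i` add up to one over the lines not parallel to
`H i`. -/
theorem sum_not_parallel {a y : Fin n → R} (H : A.IsLocalCocycle a y) (i : Fin n) :
    ∑ j with κ.slope j ≠ κ.slope i, (a j * y i - a i * y j) = 0 := by
  refine sum_eq_zero_of_fiberwise _ (fun j => A.meet (i, j)) _ fun j hj => ?_
  have hmeet : ∀ j, κ.slope j ≠ κ.slope i → ∀ q,
      (A.meet (i, j) = q ↔ q ∈ A.line i ∧ q ∈ A.line j) := by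
    intro j hj q
    have hij : i ≠ j := fun h => hj (h ▸ rfl)
    refine meet_eq_iff (p := (i, j)) hij ?_ q
    exact Set.nonempty_iff_ne_empty.2 fun h => hj ((κ.parallel_iff hij).1 h).symm
  have hj' : κ.slope j ≠ κ.slope i := (Finset.mem_filter.1 hj).2
  have hq := (hmeet j hj' _).1 rfl
  set q := A.meet (i, j)
  have hi : i ∈ A.through q := mem_through.2 hq.1
  have hfib : {k ∈ ({j | κ.slope j ≠ κ.slope i} : Finset (Fin n)) | A.meet (i, k) = q} =
      (A.through q).erase i := by
    ext k
    rw [Finset.mem_filter, Finset.mem_filter, Finset.mem_erase, mem_through]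
    constructor
    · rintro ⟨⟨-, hk⟩, h⟩
      exact ⟨fun h => hk (h ▸ rfl), ((hmeet k hk q).1 h).2⟩
    · rintro ⟨hki, hk⟩
      have hs : κ.slope k ≠ κ.slope i := fun h =>
        Set.eq_empty_iff_forall_notMem.1 ((κ.parallel_iff hki).2 h) q ⟨hk, hq.1⟩
      exact ⟨⟨Finset.mem_univ _, hs⟩, (hmeet k hs q).2 ⟨hq.1, hk⟩⟩
  rw [hfib]
  have h1 := Finset.add_sum_erase (A.through q) (fun k => a k * y i - a i * y k) hi
  have h2 : ∑ k ∈ A.through q, (a k * y i - a i * y k) = 0 := by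
    rw [Finset.sum_sub_distrib, ← Finset.sum_mul, ← Finset.mul_sum, H q i hi, sub_self]
  rwa [h2, sub_self, zero_add] at h1

variable {a y : Fin n → R}

/-- For a cocycle `y` with `∑ y i = 0`, the partial sums over classes of parallel lines vanish. -/
theorem sum_parallel_eq_zero (H : A.IsLocalCocycle a y) (hy : ∑ i, y i = 0)
    (ha : IsUnit (∑ i, a i)) (i : Fin n) : ∑ j with κ.slope j = κ.slope i, y j = 0 := by
  rw [← ha.mul_right_eq_zero]
  have hsplit : ∀ f : Fin n → R, ∀ k, κ.slope k = κ.slope i →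
      ∑ j, f j = ∑ j with κ.slope j = κ.slope i, f j + ∑ j with κ.slope j ≠ κ.slope k, f j := by
    intro f k hk
    rw [hk]
    exact (Finset.sum_filter_add_sum_filter_not _ _ _).symm
  have hk : ∀ k, κ.slope k = κ.slope i → (∑ j, a j) * y k =
      (∑ j with κ.slope j = κ.slope i, a j) * y k -
        a k * ∑ j with κ.slope j = κ.slope i, y j := by
    intro k hk
    have h1 := κ.sum_not_parallel H k
    rw [Finset.sum_sub_distrib, ← Finset.sum_mul, ← Finset.mul_sum] at h1
    have h2 := hsplit y k hk
    rw [hy] at h2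
    rw [hsplit a k hk]
    linear_combination h1 - a k * h2
  rw [Finset.mul_sum, Finset.sum_congr rfl fun k hk' => hk k (Finset.mem_filter.1 hk').2,
    Finset.sum_sub_distrib, ← Finset.mul_sum, ← Finset.sum_mul, sub_self]

theorem sum_not_parallel_mul_eq_zero (H : A.IsLocalCocycle a y) (hy : ∑ i, y i = 0)
    (ha : IsUnit (∑ i, a i)) (i : Fin n) : (∑ j with κ.slope j ≠ κ.slope i, a j) * y i = 0 := by
  have h1 := κ.sum_not_parallel H i
  rw [Finset.sum_sub_distrib, ← Finset.sum_mul, ← Finset.mul_sum] at h1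
  have h2 := Finset.sum_filter_add_sum_filter_not Finset.univ (fun j => κ.slope j = κ.slope i) y
  rw [hy, κ.sum_parallel_eq_zero H hy ha i, zero_add] at h2
  rwa [h2, mul_zero, sub_zero] at h1

/-- Classes of parallel lines that end before `H i` do not contribute to the coefficient at
`C_i`. -/
theorem partialSums_eq_sum_parallel (H : A.IsLocalCocycle a y) (hy : ∑ i, y i = 0)
    (ha : IsUnit (∑ i, a i)) (i : Fin n) :
    F.partialSums y (F.C i) = ∑ j ∈ Finset.Iic i with κ.slope j = κ.slope i, y j := by
  have h1 : F.partialSums y (F.C i) = ∑ j ∈ Finset.Iic i, y j := by simp [partialSums]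
  rw [h1, ← Finset.sum_filter_add_sum_filter_not (Finset.Iic i) (fun j => κ.slope j = κ.slope i),
    add_eq_left]
  refine sum_eq_zero_of_fiberwise _ κ.slope _ fun j hj => ?_
  rw [← κ.sum_parallel_eq_zero H hy ha j]
  refine Finset.sum_congr (Finset.ext fun k => ?_) fun _ _ => rfl
  simp only [Finset.mem_filter, Finset.mem_Iic, Finset.mem_univ, true_and] at hj ⊢
  refine ⟨And.right, fun hk => ⟨?_, hk⟩⟩
  have hlt : κ.slope i < κ.slope j := lt_of_le_of_ne (κ.slope_antitone hj.1) (Ne.symm hj.2)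
  exact ⟨(κ.lt_of_slope_lt (hk ▸ hlt)).le, hk ▸ hj.2⟩

end Flag.Coordinates

/-! ### Unbounded chambers in a band -/

namespace Flag

variable {A : LineArrangement n} (F : A.Flag)

theorem chamber_eq_of_pos_iff {C D : A.Chamber} {w z : ℝ × ℝ}
    (hw : w ∈ C.1) (hz : z ∈ D.1) (h : ∀ k, w ∈ F.pos k ↔ z ∈ F.pos k) : C = D := by
  refine C.eq_of_sign D hw hz fun k => ?_
  have hp := mul_self_pos.2 (F.form_pt_ne k)
  by_cases hk : w ∈ F.pos k
  · have h1 := F.mem_pos.1 hk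
    have h2 := F.mem_pos.1 ((h k).1 hk)
    nlinarith [mul_pos_of_neg_of_neg h1 h2]
  · have h1 := F.mem_neg.1 ((F.notMem_pos_iff (C.subset_compl hw) k).1 hk)
    have h2 := F.mem_neg.1 ((F.notMem_pos_iff (D.subset_compl hz) k).1 fun h' => hk ((h k).2 h'))
    nlinarith [mul_pos h1 h2]

theorem Band.le_or_le {F : A.Flag} (B : F.Band) (k : Fin n) :
    k ≤ B.1 ∨ B.next ≤ k := by
  rcases le_or_gt k B.1 with h | h
  · exact Or.inl h
  · exact Or.inr (Fin.mk_le_of_le_val (Nat.succ_le_of_lt h))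

theorem Band.lt_next {F : A.Flag} (B : F.Band) : B.1 < B.next :=
  Fin.mk_lt_mk.2 (Nat.lt_succ_self _)

end Flag

namespace Flag.Coordinates

variable {A : LineArrangement n} {F : A.Flag} (κ : F.Coordinates) {R : Type*} [CommRing R]
  {a : Fin n → R}

theorem mem_neg (i : Fin n) (z : ℝ × ℝ) :
    z ∈ F.neg i ↔ (κ.chart z).1 < F.cross i + κ.slope i * (κ.chart z).2 := by
  have hl : z ∈ A.line i ↔ A.form i z * A.form i F.pt = 0 := by
    rw [mul_eq_zero, or_iff_left (F.form_pt_ne i)]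
    rfl
  have h1 := (κ.mem_line i z).symm.trans hl
  have h2 := (κ.mem_pos i z).symm.trans F.mem_pos
  rw [F.mem_neg]
  constructor
  · intro h
    by_contra! h3
    rcases h3.eq_or_lt with h4 | h4
    · exact h.ne' (h1.1 h4)
    · exact h.not_gt (h2.1 h4)
  · intro h
    by_contra! h3
    rcases h3.eq_or_lt with h4 | h4
    · exact h.ne' (h1.2 h4)
    · exact h.not_gt (h2.2 h4)

theorem not_isBounded_of_heights {U : Set (ℝ × ℝ)} (h : ∀ b, ∃ w ∈ U, b < |(κ.chart w).2|) :
    ¬ Bornology.IsBounded U := by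
  intro hU
  have hc : IsCompact ((fun w => |(κ.chart w).2|) '' closure U) :=
    hU.isCompact_closure.image (by fun_prop)
  obtain ⟨b, hb⟩ := hc.bddAbove
  obtain ⟨w, hw, hlt⟩ := h b
  exact hlt.not_ge (hb ⟨w, subset_closure hw, rfl⟩)

theorem slope_next (B : F.Band) : κ.slope B.next = κ.slope B.1 :=
  ((κ.parallel_iff B.lt_next.ne).1 B.2.2).symm

theorem mem_region (B : F.Band) (z : ℝ × ℝ) : z ∈ B.region ↔
    F.cross B.1 + κ.slope B.1 * (κ.chart z).2 < (κ.chart z).1 ∧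
      (κ.chart z).1 < F.cross B.next + κ.slope B.1 * (κ.chart z).2 := by
  rw [Band.region, Set.mem_inter_iff, κ.mem_pos, κ.mem_neg, κ.slope_next]

/-- The point of the middle line of a band at a given height. -/
def middle (B : F.Band) (h : ℝ) : ℝ × ℝ :=
  κ.chart.symm ((F.cross B.1 + F.cross B.next) / 2 + κ.slope B.1 * h, h)

theorem chart_middle (B : F.Band) (h : ℝ) : κ.chart (κ.middle B h) =
    ((F.cross B.1 + F.cross B.next) / 2 + κ.slope B.1 * h, h) :=
  κ.chart.apply_symm_apply _

theorem middle_mem_region (B : F.Band) (h : ℝ) : κ.middle B h ∈ B.region := by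
  have := F.cross_strictMono B.lt_next
  rw [mem_region, chart_middle]
  constructor <;> dsimp only <;> linarith

/-- In the part of a band below `F¹`, the lines are in the order of their numbers. -/
theorem region_low (B : F.Band) {z : ℝ × ℝ} (hz : z ∈ B.region) (h0 : (κ.chart z).2 ≤ 0) :
    z ∈ A.compl ∧ ∀ k, z ∈ F.pos k ↔ k ≤ B.1 := by
  rw [κ.mem_region] at hz
  have hle : ∀ k ≤ B.1, F.cross k + κ.slope k * (κ.chart z).2 < (κ.chart z).1 := by
    intro k hk
    have h1 := F.cross_strictMono.monotone hk
    have h2 := mul_le_mul_of_nonpos_right (κ.slope_antitone hk) h0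
    linarith
  have hge : ∀ k, B.next ≤ k → (κ.chart z).1 < F.cross k + κ.slope k * (κ.chart z).2 := by
    intro k hk
    have h1 := F.cross_strictMono.monotone hk
    have h2 := mul_le_mul_of_nonpos_right (κ.slope_antitone hk) h0
    rw [κ.slope_next] at h2
    linarith
  refine ⟨fun k hk => ?_, fun k => ?_⟩
  · rw [κ.mem_line] at hk
    rcases B.le_or_le k with h | h
    · exact (hle k h).ne hk
    · exact (hge k h).ne' hk
  · rw [κ.mem_pos]
    refine ⟨fun h => (B.le_or_le k).resolve_right fun h' => ?_, hle k⟩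
    exact (hge k h').not_gt h

/-- High above `F¹`, the lines of larger slope are on one side of a band, and those of smaller slope
are on the other side. -/
theorem exists_region_high (B : F.Band) : ∃ T : ℝ, 0 < T ∧ ∀ z ∈ B.region, T ≤ (κ.chart z).2 →
    z ∈ A.compl ∧ ∀ k, z ∈ F.pos k ↔
      κ.slope k < κ.slope B.1 ∨ κ.slope k = κ.slope B.1 ∧ k ≤ B.1 := by
  have hev : ∀ᶠ T : ℝ in Filter.atTop, ∀ k,
      (κ.slope k < κ.slope B.1 → (F.cross k - F.cross B.1) / (κ.slope B.1 - κ.slope k) ≤ T) ∧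
        (κ.slope B.1 < κ.slope k →
          (F.cross B.next - F.cross k) / (κ.slope k - κ.slope B.1) ≤ T) :=
    Filter.eventually_all.2 fun k =>
      ((Filter.eventually_ge_atTop _).mono fun _ h _ => h).and
        ((Filter.eventually_ge_atTop _).mono fun _ h _ => h)
  obtain ⟨T, hT, hT0⟩ := (hev.and (Filter.eventually_gt_atTop 0)).exists
  refine ⟨T, hT0, fun z hz hzT => ?_⟩
  rw [κ.mem_region] at hz
  set h := (κ.chart z).2
  have hle : ∀ k, κ.slope k < κ.slope B.1 ∨ κ.slope k = κ.slope B.1 ∧ k ≤ B.1 →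
      F.cross k + κ.slope k * h < (κ.chart z).1 := by
    rintro k (hk | ⟨hk, hk'⟩)
    · have h1 := ((hT k).1 hk).trans hzT
      rw [div_le_iff₀ (by linarith)] at h1
      linarith
    · have h1 := F.cross_strictMono.monotone hk'
      rw [hk]
      linarith
  have hge : ∀ k, ¬ (κ.slope k < κ.slope B.1 ∨ κ.slope k = κ.slope B.1 ∧ k ≤ B.1) →
      (κ.chart z).1 < F.cross k + κ.slope k * h := by
    intro k hk
    rw [not_or, not_and, not_lt] at hk
    rcases hk.1.eq_or_lt with h1 | h1
    · have h2 := F.cross_strictMono.monotone ((B.le_or_le k).resolve_left (hk.2 h1.symm))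
      rw [← h1]
      linarith
    · have h2 := ((hT k).2 h1).trans hzT
      rw [div_le_iff₀ (by linarith)] at h2
      linarith
  refine ⟨fun k hk => ?_, fun k => ?_⟩
  · rw [κ.mem_line] at hk
    by_cases hk' : κ.slope k < κ.slope B.1 ∨ κ.slope k = κ.slope B.1 ∧ k ≤ B.1
    · exact (hle k hk').ne hk
    · exact (hge k hk').ne' hk
  · rw [κ.mem_pos]
    refine ⟨fun h => by_contra fun h' => ?_, hle k⟩
    exact (hge k h').not_gt h

theorem isBounded_region_between (B : F.Band) (T : ℝ) :
    Bornology.IsBounded {z ∈ B.region | 0 ≤ (κ.chart z).2 ∧ (κ.chart z).2 ≤ T} := by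
  have hc : IsCompact (κ.chart.symm '' (Set.Icc (F.cross B.1 - |κ.slope B.1| * T)
      (F.cross B.next + |κ.slope B.1| * T) ×ˢ Set.Icc 0 T)) :=
    (isCompact_Icc.prod isCompact_Icc).image κ.chart.symm.continuous
  refine hc.isBounded.subset ?_
  rintro z ⟨hz, h0, hT⟩
  rw [κ.mem_region] at hz
  have h1 : |κ.slope B.1 * (κ.chart z).2| ≤ |κ.slope B.1| * T := by
    rw [abs_mul, abs_of_nonneg h0]
    exact mul_le_mul_of_nonneg_left hT (abs_nonneg _)
  rw [abs_le] at h1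
  exact ⟨κ.chart z, ⟨⟨by linarith, by linarith⟩, h0, hT⟩, κ.chart.symm_apply_apply z⟩

/-- A band is resonant if the lines that are not parallel to it have sum zero. -/
theorem isResonant (B : F.Band) (ha : ∑ k with κ.slope k ≠ κ.slope B.1, a k = 0) :
    B.IsResonant a := by
  obtain ⟨T, hT0, hT⟩ := κ.exists_region_high B
  have hchart2 : ∀ h, (κ.chart (κ.middle B h)).2 = h := fun h => by rw [chart_middle]
  obtain ⟨hU₂c, hU₂p⟩ := hT _ (κ.middle_mem_region B T) (hchart2 T).ge
  obtain ⟨u, hu⟩ := B.U₁.1.nonempty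
  have hup : ∀ k, u ∈ F.pos k ↔ k ≤ B.1 := fun k => F.C_subset_pos_iff B.1 k hu
  have hm := A.mem_chamberAt _ hU₂c
  have hlow : ∀ (U : A.Chamber), ∀ z ∈ U.1, z ∈ B.region → (κ.chart z).2 ≤ 0 → U = B.U₁.1 :=
    fun U z hz hzB h0 => F.chamber_eq_of_pos_iff hz hu fun k =>
      ((κ.region_low B hzB h0).2 k).trans (hup k).symm
  have hhigh : ∀ (U : A.Chamber), ∀ z ∈ U.1, z ∈ B.region → T ≤ (κ.chart z).2 →
      U = A.chamberAt _ hU₂c :=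
    fun U z hz hzB h0 => F.chamber_eq_of_pos_iff hz hm fun k =>
      ((hT z hzB h0).2 k).trans (hU₂p k).symm
  refine ⟨A.chamberAt _ hU₂c, Set.ext fun U => ?_, ?_⟩
  · rw [Set.mem_insert_iff, Set.mem_singleton_iff]
    constructor
    · rintro ⟨hUB, hU⟩
      by_contra! hne
      refine hU ((κ.isBounded_region_between B T).subset fun z hz => ⟨hUB hz, ?_, ?_⟩)
      · by_contra! h
        exact hne.1 (hlow U z hz (hUB hz) h.le)
      · by_contra! h
        exact hne.2 (hhigh U z hz (hUB hz) h.le)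
    · rintro (rfl | rfl)
      · refine ⟨B.U₁_spec.1, κ.not_isBounded_of_heights fun b => ?_⟩
        have h0 : -(|b| + 1) ≤ 0 := by linarith [abs_nonneg b]
        have hc := (κ.region_low B (κ.middle_mem_region B (-(|b| + 1))) (by rwa [hchart2])).1
        refine ⟨κ.middle B (-(|b| + 1)), ?_, ?_⟩
        · rw [← hlow _ _ (A.mem_chamberAt _ hc) (κ.middle_mem_region B _) (by rwa [hchart2])]
          exact A.mem_chamberAt _ hc
        · rw [hchart2, abs_neg, abs_of_pos (by positivity)]
          linarith [le_abs_self b]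
      · refine ⟨fun z hz => ⟨?_, ?_⟩, κ.not_isBounded_of_heights fun b => ?_⟩
        · rw [F.mem_pos_iff_of_mem_chamber hz hm, hU₂p]
          exact Or.inr ⟨rfl, le_rfl⟩
        · rw [← F.notMem_pos_iff (Chamber.subset_compl _ hz), F.mem_pos_iff_of_mem_chamber hz hm,
            hU₂p, κ.slope_next, not_or]
          exact ⟨lt_irrefl _, fun h => B.lt_next.not_ge h.2⟩
        · have h0 : T ≤ |b| + T := by linarith [abs_nonneg b]
          have hc := (hT _ (κ.middle_mem_region B (|b| + T)) (by rwa [hchart2])).1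
          refine ⟨κ.middle B (|b| + T), ?_, ?_⟩
          · rw [← hhigh _ _ (A.mem_chamberAt _ hc) (κ.middle_mem_region B _) (by rwa [hchart2])]
            exact A.mem_chamberAt _ hc
          · rw [hchart2, abs_of_pos (by positivity)]
            linarith [le_abs_self b]
  · rw [← ha]
    refine Finset.sum_congr (Finset.ext fun k => ?_) fun _ _ => rfl
    rw [F.mem_Sep_iff hu hm, hup, hU₂p, Finset.mem_filter]
    simp only [Finset.mem_univ, true_and]
    rcases lt_trichotomy (κ.slope k) (κ.slope B.1) with h | h | h
    · simp [h, h.ne, κ.lt_of_slope_lt h]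
    · simp [h]
    · simp [h.ne', h.not_gt, (κ.lt_of_slope_lt h).le]

end Flag.Coordinates

/-! ### Injectivity and surjectivity -/

namespace Flag

variable {A : LineArrangement n} (F : A.Flag) {R : Type*} [CommRing R] (a : Fin n → R)

theorem U₁_apply_C (x : F.RB a → R) (i : Fin n) :
    F.U₁ a x (F.C i) = ∑ B : F.RB a, if i = B.1.1 then x B else 0 := by
  rw [U₁, Fintype.linearCombination_apply, Finset.sum_apply]
  refine Finset.sum_congr rfl fun B _ => ?_
  simp [Band.U₁, Pi.single_apply]

theorem U₁_apply_band (x : F.RB a → R) (B : F.RB a) : F.U₁ a x (F.C B.1.1) = x B := by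
  rw [U₁_apply_C, Finset.sum_eq_single B]
  · simp
  · intro B' _ hne
    exact if_neg fun h => hne (Subtype.ext (Subtype.ext h.symm))
  · simp

theorem U₁_apply_of_not_band (x : F.RB a → R) {i : Fin n} (hi : ∀ B : F.RB a, i ≠ B.1.1) :
    F.U₁ a x (F.C i) = 0 := by
  rw [U₁_apply_C]
  exact Finset.sum_eq_zero fun B _ => if_neg (hi B)

theorem partialSums_last (y : Fin n → R) {i : Fin n} (hi : i.1 + 1 = n) :
    F.partialSums y (F.C i) = ∑ j, y j := by
  rw [partialSums_C, hi, Finset.sum_range]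
  simp

/-- The chamber after the last line is in no band, and the coefficient of the coboundary at it is
the sum of all `a i`. -/
theorem U₁Tilde_injective (ha : IsUnit (∑ i, a i)) : Function.Injective (F.U₁Tilde a) := by
  rw [← LinearMap.ker_eq_bot, LinearMap.ker_eq_bot']
  intro x hx
  rw [U₁Tilde, LinearMap.comp_apply, Submodule.mkQ_apply, Submodule.Quotient.mk_eq_zero,
    mem_submoduleOf_iff, F.range_nabla₀, Submodule.mem_span_singleton] at hx
  obtain ⟨r, hr⟩ := hx
  have hr' : r • F.partialSums a = F.U₁ a x.1 := hr
  refine Subtype.ext (funext fun B => ?_)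
  let l : Fin n := ⟨n - 1, by have := B.1.1.2; omega⟩
  have hl : l.1 + 1 = n := by have := B.1.1.2; simp only [l]; omega
  have h1 := congrFun hr' (F.C l)
  rw [Pi.smul_apply, F.partialSums_last a hl, smul_eq_mul, F.U₁_apply_of_not_band,
    ha.mul_left_eq_zero] at h1
  · have h2 := F.U₁_apply_band a x.1 B
    rw [← hr', h1, zero_smul] at h2
    exact h2.symm
  · rintro B' h
    have := B'.1.2.1
    rw [← h, hl] at this
    exact lt_irrefl _ this

/-- Every class is represented by a cocycle whose coefficient at the last chamber vanishes. If
such cocycles are supported on resonant bands, then they come from `U₁`. -/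
theorem U₁Tilde_surjective (ha : IsUnit (∑ i, a i))
    (hsupp : ∀ y, A.IsLocalCocycle a y → ∑ i, y i = 0 → ∀ i, F.partialSums y (F.C i) ≠ 0 →
      ∃ B : F.RB a, B.1.1 = i) : Function.Surjective (F.U₁Tilde a) := by
  intro c
  obtain ⟨⟨z, hz⟩, rfl⟩ := Submodule.Quotient.mk_surjective _ c
  obtain ⟨y, rfl⟩ := F.partialSums_surjective z
  obtain ⟨u, hu⟩ := ha
  set r := (∑ i, y i) * (u⁻¹ : Rˣ) with hr
  set y' := y - r • a with hy'
  have hsum : ∑ i, y' i = 0 := by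
    simp only [hy', Pi.sub_apply, Pi.smul_apply, smul_eq_mul, Finset.sum_sub_distrib,
      ← Finset.mul_sum]
    rw [← hu, hr, mul_assoc, Units.inv_mul, mul_one, sub_self]
  have hker : F.nabla₁ a (F.partialSums y') = 0 := by
    have h1 : F.nabla₁ a (F.partialSums a) = 0 :=
      (F.nabla₁_partialSums_eq_zero_iff a a).2 fun q i _ => mul_comm _ _
    rw [hy', map_sub, map_smul, map_sub, map_smul, h1, smul_zero, sub_zero]
    exact hz
  let x : F.RB a → R := fun B => F.partialSums y' (F.C B.1.1)
  have hx : F.U₁ a x = F.partialSums y' := by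
    ext C
    obtain ⟨i, rfl⟩ := F.C.surjective C
    by_cases hi : ∃ B : F.RB a, B.1.1 = i
    · obtain ⟨B, rfl⟩ := hi
      exact F.U₁_apply_band a x B
    · rw [F.U₁_apply_of_not_band a x fun B h => hi ⟨B, h.symm⟩]
      by_contra hne
      exact hi (hsupp y' ((F.nabla₁_partialSums_eq_zero_iff a y').1 hker) hsum i (Ne.symm hne))
  refine ⟨⟨x, ?_⟩, ?_⟩
  · rw [LinearMap.mem_ker, nablaTilde, LinearMap.neg_apply, LinearMap.comp_apply, hx, hker, neg_zero]
  · rw [U₁Tilde, LinearMap.comp_apply, Submodule.mkQ_apply, Submodule.Quotient.eq,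
      mem_submoduleOf_iff, F.range_nabla₀, Submodule.mem_span_singleton]
    refine ⟨-r, ?_⟩
    show _ = F.U₁ a x - F.partialSums y
    rw [hx, hy', map_sub, map_smul]
    module

/-- The coefficient at `C_i` vanishes unless `H i` and `H (i+1)` bound a band. -/
theorem exists_band_of_partialSums_ne_zero {a y : Fin n → R} (H : A.IsLocalCocycle a y)
    (hy : ∑ i, y i = 0) (ha : IsUnit (∑ i, a i)) (i : Fin n) (hi : F.partialSums y (F.C i) ≠ 0) :
    ∃ h : i.1 + 1 < n, A.line i ∩ A.line ⟨i.1 + 1, h⟩ = ∅ := by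
  obtain ⟨κ⟩ := F.nonempty_coordinates
  by_contra hcon
  have hnot : ∀ h : i.1 + 1 < n, κ.slope i ≠ κ.slope ⟨i.1 + 1, h⟩ := fun h he =>
    hcon ⟨h, (κ.parallel_iff (Fin.ne_of_val_ne (by simp))).2 he⟩
  apply hi
  rw [κ.partialSums_eq_sum_parallel H hy ha, ← κ.sum_parallel_eq_zero H hy ha i]
  refine Finset.sum_congr (Finset.ext fun k => ?_) fun _ _ => rfl
  simp only [Finset.mem_filter, Finset.mem_Iic, Finset.mem_univ, true_and, and_iff_right_iff_imp]
  intro hk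
  by_contra! hlt
  have hn : i.1 + 1 < n := lt_of_le_of_lt (Nat.succ_le_of_lt hlt) k.2
  have h1 : κ.slope k ≤ κ.slope ⟨i.1 + 1, hn⟩ :=
    κ.slope_antitone (Fin.mk_le_of_le_val (Nat.succ_le_of_lt hlt))
  have h2 : κ.slope ⟨i.1 + 1, hn⟩ ≤ κ.slope i :=
    κ.slope_antitone (Fin.mk_le_mk.2 (Nat.le_succ _))
  exact hnot hn (le_antisymm (hk ▸ h1) h2)

theorem exists_RB_of_isDomain [IsDomain R] (ha : IsUnit (∑ i, a i)) {y : Fin n → R}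
    (H : A.IsLocalCocycle a y) (hy : ∑ i, y i = 0) (i : Fin n)
    (hi : F.partialSums y (F.C i) ≠ 0) : ∃ B : F.RB a, B.1.1 = i := by
  obtain ⟨κ⟩ := F.nonempty_coordinates
  let B : F.Band := ⟨i, F.exists_band_of_partialSums_ne_zero H hy ha i hi⟩
  refine ⟨⟨B, κ.isResonant B ?_⟩, rfl⟩
  rw [κ.partialSums_eq_sum_parallel H hy ha] at hi
  obtain ⟨j, hj, hyj⟩ := Finset.exists_ne_zero_of_sum_ne_zero hi
  have h1 := κ.sum_not_parallel_mul_eq_zero H hy ha j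
  rw [(Finset.mem_filter.1 hj).2] at h1
  exact (mul_eq_zero.1 h1).resolve_right hyj

theorem exists_RB_of_forall_isResonant (ha : IsUnit (∑ i, a i))
    (hres : ∀ B : F.Band, B.IsResonant a) {y : Fin n → R} (H : A.IsLocalCocycle a y)
    (hy : ∑ i, y i = 0) (i : Fin n) (hi : F.partialSums y (F.C i) ≠ 0) :
    ∃ B : F.RB a, B.1.1 = i := by
  exact ⟨⟨⟨i, F.exists_band_of_partialSums_ne_zero H hy ha i hi⟩, hres _⟩, rfl⟩

end Flag

end

end LineArrangement

theorem theorem4p10 {n : ℕ} (A : LineArrangement n) (F : A.Flag) {R : Type*} [CommRing R]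
    (a : Fin n → R) :
    -- the chamber complex is a complex, and `φ` identifies its `H¹` with that of `(A_R, η)`
    (F.nabla₁ a ∘ₗ F.nabla₀ a = 0 ∧
      ∃ φ : F.H1 a ≃ₗ[R] A.AomotoH1 a, ∀ z : LinearMap.ker (F.nabla₁ a),
        ∃ hz : F.phi₁ z.1 ∈ A.aomotoZ1 a,
          φ (Submodule.Quotient.mk z) = Submodule.Quotient.mk ⟨F.phi₁ z.1, hz⟩) ∧
    -- injectivity
    (IsUnit (∑ i, a i) → Function.Injective (F.U₁Tilde a)) ∧
    -- bijectivity over an integral domain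
    (IsDomain R → IsUnit (∑ i, a i) → Function.Bijective (F.U₁Tilde a)) ∧
    -- bijectivity over any ring, if all bands are resonant
    (IsUnit (∑ i, a i) → (∀ B : F.Band, B.IsResonant a) →
      Function.Bijective (F.U₁Tilde a)) := by
  refine ⟨⟨F.nabla₁_nabla₀ a, F.exists_cohomology_equiv a⟩, F.U₁Tilde_injective a,
    fun _ ha => ⟨F.U₁Tilde_injective a ha, ?_⟩, fun ha hres => ⟨F.U₁Tilde_injective a ha, ?_⟩⟩
  · exact F.U₁Tilde_surjective a ha fun _ H hy i hi => F.exists_RB_of_isDomain a ha H hy i hi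
  · exact F.U₁Tilde_surjective a ha fun _ H hy i hi =>
      F.exists_RB_of_forall_isResonant a ha hres H hy i hi
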